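/- Let $s\ge 2$ be an integer and let $A$ be a random set of positive integers (on a probability space) such that the events $\{n\in A\}$, $n\ge 1$, are independent and $P(n\in A)=\frac1s\,n^{-1+1/s}$ for every $n\ge 1$. Let $sA=\{a_1+\cdots+a_s : a_1,\dots,a_s\in A\}$ (repetitions allowed). Then, almost surely, $sA$ is infinite and, writing $b_1<b_2<\cdots$ for its elements in increasing order, $$\limsup_{n\to\infty}\frac{b_{n+1}-b_n}{\log b_n}=\frac{s^s\,s!}{\Gamma(1/s)^s}.$$ The right-hand side equals $1/\lambda_s$, where $\lambda_s=\dfrac{\Gamma(1/s)^s}{s^s\,s!}$. -/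

import Mathlib

open MeasureTheory ProbabilityTheory Filter

/-- `A` is a random pseudo `s`-th power sequence on the probability space `(U, P)`: a random set of
positive integers such that the events `n ∈ A` are independent and
`P(n ∈ A) = (1/s) * n ^ (-1 + 1/s)` for every `n ≥ 1`. -/
structure IsPseudoPowerSequence {U : Type*} [MeasurableSpace U] (P : Measure U) (s : ℕ)
    (A : U → Set ℕ) : Prop where
  pos : ∀ u : U, ∀ n ∈ A u, 1 ≤ n
  measurableSet_mem : ∀ n : ℕ, MeasurableSet {u : U | n ∈ A u}
  indep : iIndepSet (fun n : ℕ => {u : U | n ∈ A u}) P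
  prob_mem : ∀ n : ℕ, 1 ≤ n →
    P.real {u : U | n ∈ A u} = (1 / (s : ℝ)) * (n : ℝ) ^ (-1 + 1 / (s : ℝ))

/-- The `s`-fold sumset `sA = {a_1 + ⋯ + a_s : a_i ∈ A}` (repetitions allowed). -/
def foldSumset (s : ℕ) (A : Set ℕ) : Set ℕ :=
  {m | ∃ a : Fin s → ℕ, (∀ i, a i ∈ A) ∧ ∑ i, a i = m}

/-- The elements of a set of natural numbers, enumerated in increasing order, starting at
index `0` (meaningful at every index when the set is infinite). -/
noncomputable def increasingEnum (B : Set ℕ) (n : ℕ) : ℕ := Nat.nth (fun m => m ∈ B) n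

/-- `λ_s = Γ(1/s)^s / (s^s s!)`. -/
noncomputable def poissonParam (s : ℕ) : ℝ :=
  Real.Gamma (1 / (s : ℝ)) ^ s / ((s : ℝ) ^ s * (Nat.factorial s : ℝ))

/-!
For a finite set `T` of large integers, let `X_T` be the number of `s`-element subsets of the random
set `A` whose sum lies in `T`. Its mean is `∑ m ∈ T, repMean s s m`, and `repMean s s m → λ`. The
point is that, uniformly in sets `T ⊆ [X, ∞)` with at most `C log X` elements, the probability that
`sA` misses `T` is `exp (-∑ m ∈ T, repMean s s m + o(1))` (`eventually_avoidProb_bounds`), as if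
`X_T` were a Poisson variable.

* The limit of `repMean s s m` comes from the power series `(1 - X) ^ (-1/s)`, whose coefficients
  are asymptotic to `n ^ (-1 + 1/s) / Γ(1/s)` by Euler's limit formula for the Gamma function. Its
  `s`-th power is `(1 - X)⁻¹`, with all coefficients equal to `1`, so no Beta integral is needed
  (`tendsto_coeff_memSeries_pow`). The other powers `(1 - X) ^ (-k/s)`, `k < s`, have
  coefficients at most `(n + 1) ^ (-1/s)`, which controls every error term.
* The upper bound for the probability is Janson's inequality (`avoidProb_le_exp`), the lower
  bound is positive correlation of decreasing events (`prod_one_sub_le_avoidProb`). Both are proved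
  by adding one forbidden set at a time. Overlapping pairs of representations
  (`sum_overlappingPairs_le`) and representations with a repeated summand
  (`exists_sum_not_injective_le`) are negligible.

If `c > 1 / λ`, an interval of length `c log x` after `x` is missed with probability `O(x ^ (-a))`
for some `a > 1`, so by Borel–Cantelli all large gaps are at most `c log x`. If `c < 1 / λ`, cut
`[X, 2X)` into windows of length about `c log X`. The expected number of windows missed by `sA` is
at least `X ^ b` for some `b > 0`, and the estimate applied to unions of two windows shows that these
events are almost pairwise independent. By the second moment method some window is missed with
probability tending to `1` as `X → ∞`, hence almost surely for infinitely many `X`.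
-/

namespace PseudoPower

/-! ### Random subsets of a finite set and Janson's inequality -/

section Bernoulli

variable {ι : Type*} [DecidableEq ι]

/-- The expectation of `g R`, where `R` is the random subset of the finite set `V` that contains
each `i ∈ V` independently with probability `p i`. -/
noncomputable def bernoulliMean (p : ι → ℝ) (V : Finset ι) (g : Finset ι → ℝ) : ℝ :=
  ∑ R ∈ V.powerset, ((∏ i ∈ R, p i) * ∏ i ∈ V \ R, (1 - p i)) * g R

variable {p : ι → ℝ} {V : Finset ι}

lemma bernoulliMean_insert {a : ι} (ha : a ∉ V) (g : Finset ι → ℝ) :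
    bernoulliMean p (insert a V) g =
      (1 - p a) * bernoulliMean p V g + p a * bernoulliMean p V (fun R => g (insert a R)) := by
  unfold bernoulliMean
  rw [Finset.sum_powerset_insert ha, Finset.mul_sum, Finset.mul_sum]
  congr 1
  · refine Finset.sum_congr rfl fun R hR => ?_
    have haR : a ∉ R := fun h => ha (Finset.mem_powerset.1 hR h)
    rw [Finset.insert_sdiff_of_notMem _ haR, Finset.prod_insert (by simp [ha])]
    ring
  · refine Finset.sum_congr rfl fun R hR => ?_
    have haR : a ∉ R := fun h => ha (Finset.mem_powerset.1 hR h)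
    rw [Finset.prod_insert haR, Finset.insert_sdiff_insert, Finset.sdiff_insert_of_notMem ha]
    ring

lemma bernoulliMean_one : bernoulliMean p V (fun _ => 1) = 1 := by
  induction V using Finset.induction_on with
  | empty => simp [bernoulliMean]
  | insert a V ha ih => rw [bernoulliMean_insert ha, ih]; ring

lemma bernoulliMean_sub (g h : Finset ι → ℝ) :
    bernoulliMean p V (fun R => g R - h R) = bernoulliMean p V g - bernoulliMean p V h := by
  simp only [bernoulliMean, mul_sub, Finset.sum_sub_distrib]

lemma bernoulliMean_sum {κ : Type*} (J : Finset κ) (g : κ → Finset ι → ℝ) :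
    bernoulliMean p V (fun R => ∑ j ∈ J, g j R) = ∑ j ∈ J, bernoulliMean p V (g j) := by
  simp only [bernoulliMean, Finset.mul_sum]
  exact Finset.sum_comm

lemma bernoulliMean_mono (h0 : ∀ i, 0 ≤ p i) (h1 : ∀ i, p i ≤ 1) {g h : Finset ι → ℝ}
    (hgh : ∀ R, g R ≤ h R) : bernoulliMean p V g ≤ bernoulliMean p V h := by
  refine Finset.sum_le_sum fun R _ => mul_le_mul_of_nonneg_left (hgh R) ?_
  exact mul_nonneg (Finset.prod_nonneg fun i _ => h0 i)
    (Finset.prod_nonneg fun i _ => sub_nonneg.2 (h1 i))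

lemma bernoulliMean_mem {a : ι} (ha : a ∈ V) (g : Finset ι → ℝ) :
    bernoulliMean p V (fun R => if a ∈ R then g R else 0) =
      p a * bernoulliMean p V (fun R => g (insert a R)) := by
  obtain ⟨W, haW, rfl⟩ : ∃ W, a ∉ W ∧ insert a W = V :=
    ⟨V.erase a, Finset.notMem_erase a V, Finset.insert_erase ha⟩
  rw [bernoulliMean_insert haW, bernoulliMean_insert haW]
  have : bernoulliMean p W (fun R => if a ∈ R then g R else 0) = 0 := by
    refine Finset.sum_eq_zero fun R hR => ?_
    have haR : a ∉ R := fun h => haW (Finset.mem_powerset.1 hR h)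
    simp [haR]
  rw [this]
  simp only [Finset.mem_insert_self, if_true, Finset.insert_idem]
  ring

/-- Conditionally on `S ⊆ R`, the random set `R` is distributed as `S ∪ R`. -/
lemma bernoulliMean_superset {S : Finset ι} (hS : S ⊆ V) (g : Finset ι → ℝ) :
    bernoulliMean p V (fun R => if S ⊆ R then g R else 0) =
      (∏ i ∈ S, p i) * bernoulliMean p V (fun R => g (S ∪ R)) := by
  induction S using Finset.induction_on generalizing g with
  | empty => simp
  | insert a S ha ih =>
    have h1 : (fun R => if insert a S ⊆ R then g R else 0) =
        fun R => if a ∈ R then (if S ⊆ R then g R else 0) else 0 := by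
      funext R
      by_cases h : a ∈ R <;> simp [Finset.insert_subset_iff, h]
    have h2 : ∀ R, S ⊆ insert a R ↔ S ⊆ R := fun R => Finset.subset_insert_iff_of_notMem ha
    rw [h1, bernoulliMean_mem (hS (Finset.mem_insert_self a S)), Finset.prod_insert ha]
    simp only [h2]
    rw [ih ((Finset.subset_insert a S).trans hS) (fun R => g (insert a R)), mul_assoc]
    simp only [Finset.insert_union]

/-- The probability that the random subset of `V` contains no member of the family `F`. -/
noncomputable def avoidProb (p : ι → ℝ) (V : Finset ι) (F : Finset (Finset ι)) : ℝ :=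
  bernoulliMean p V (fun R => if ∀ S ∈ F, ¬ S ⊆ R then 1 else 0)

lemma avoidProb_empty : avoidProb p V ∅ = 1 := by
  simp [avoidProb, bernoulliMean_one]

lemma avoidProb_nonneg (h0 : ∀ i, 0 ≤ p i) (h1 : ∀ i, p i ≤ 1) (F : Finset (Finset ι)) :
    0 ≤ avoidProb p V F := by
  have := bernoulliMean_mono (V := V) h0 h1 (g := fun _ => 0)
    (h := fun R => if ∀ S ∈ F, ¬ S ⊆ R then 1 else 0) (fun R => by split_ifs <;> norm_num)
  simpa [avoidProb, bernoulliMean] using this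

lemma avoidProb_anti (h0 : ∀ i, 0 ≤ p i) (h1 : ∀ i, p i ≤ 1) {F G : Finset (Finset ι)}
    (hFG : F ⊆ G) : avoidProb p V G ≤ avoidProb p V F := by
  refine bernoulliMean_mono h0 h1 fun R => ?_
  by_cases h : ∀ S ∈ G, ¬ S ⊆ R
  · rw [if_pos h, if_pos fun S hS => h S (hFG hS)]
  · rw [if_neg h]; split_ifs <;> norm_num

lemma avoidProb_insert (S : Finset ι) (F : Finset (Finset ι)) :
    avoidProb p V (insert S F) = avoidProb p V F -
      bernoulliMean p V (fun R => if S ⊆ R then (if ∀ S' ∈ F, ¬ S' ⊆ R then 1 else 0) else 0) := by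
  rw [avoidProb, avoidProb, ← bernoulliMean_sub]
  congr 1
  funext R
  by_cases h : S ⊆ R <;> simp [h]

/-- The events that the random set does not contain `S`, for `S ∈ F`, are positively correlated.
This is the case of Harris' inequality that is needed here. -/
lemma prod_one_sub_le_avoidProb (h0 : ∀ i, 0 ≤ p i) (h1 : ∀ i, p i ≤ 1) (F : Finset (Finset ι))
    (hF : ∀ S ∈ F, S ⊆ V) : ∏ S ∈ F, (1 - ∏ i ∈ S, p i) ≤ avoidProb p V F := by
  induction F using Finset.induction_on with
  | empty => simp [avoidProb_empty]
  | insert S F hS ih =>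
    rw [Finset.prod_insert hS, avoidProb_insert,
      bernoulliMean_superset (hF S (Finset.mem_insert_self S F))]
    have hp0 : 0 ≤ ∏ i ∈ S, p i := Finset.prod_nonneg fun i _ => h0 i
    have hp1 : ∏ i ∈ S, p i ≤ 1 := Finset.prod_le_one (fun i _ => h0 i) fun i _ => h1 i
    have hle : bernoulliMean p V (fun R => if ∀ S' ∈ F, ¬ S' ⊆ S ∪ R then 1 else 0) ≤
        avoidProb p V F := by
      refine bernoulliMean_mono h0 h1 fun R => ?_
      by_cases h : ∀ S' ∈ F, ¬ S' ⊆ S ∪ R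
      · rw [if_pos h, if_pos fun S' hS' hR => h S' hS' (hR.trans Finset.subset_union_right)]
      · rw [if_neg h]; split_ifs <;> norm_num
    have ih' := ih fun S' hS' => hF S' (Finset.mem_insert_of_mem hS')
    have e1 := mul_le_mul_of_nonneg_left hle hp0
    have e2 := mul_le_mul_of_nonneg_left ih' (sub_nonneg.2 hp1)
    linarith

/-- The pairs of distinct, non-disjoint members of `F`. -/
def overlappingPairs (F : Finset (Finset ι)) : Finset (Finset ι × Finset ι) :=
  (F ×ˢ F).filter fun q => q.1 ≠ q.2 ∧ ¬ Disjoint q.1 q.2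

/-- The conditional probability step of Janson's inequality: given that no member of `F` occurs,
`S` still occurs with almost its unconditional probability. -/
lemma le_bernoulliMean_superset_avoid (h0 : ∀ i, 0 ≤ p i) (h1 : ∀ i, p i ≤ 1)
    {S : Finset ι} {F : Finset (Finset ι)} (hS : S ⊆ V) (hF : ∀ S' ∈ F, S' ⊆ V) :
    ((∏ i ∈ S, p i) - ∑ S' ∈ F.filter (fun S' => ¬ Disjoint S S'), ∏ i ∈ S ∪ S', p i) *
      avoidProb p V F ≤
    bernoulliMean p V (fun R => if S ⊆ R then (if ∀ S' ∈ F, ¬ S' ⊆ R then 1 else 0) else 0) := by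
  set D := F.filter (fun S' => Disjoint S S') with hD
  set N := F.filter (fun S' => ¬ Disjoint S S') with hN
  set x := (∏ i ∈ S, p i) - ∑ S' ∈ N, ∏ i ∈ S ∪ S', p i with hx
  have key : x * avoidProb p V D ≤
      bernoulliMean p V (fun R => if S ⊆ R then (if ∀ S' ∈ F, ¬ S' ⊆ R then 1 else 0) else 0) := by
    have hpt : ∀ R : Finset ι, (if S ⊆ R then (if ∀ S' ∈ D, ¬ S' ⊆ R then (1 : ℝ) else 0) else 0) -
        ∑ S' ∈ N, (if S ∪ S' ⊆ R then (if ∀ S' ∈ D, ¬ S' ⊆ R then (1 : ℝ) else 0) else 0) ≤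
        (if S ⊆ R then (if ∀ S' ∈ F, ¬ S' ⊆ R then 1 else 0) else 0) := by
      intro R
      have hsum : 0 ≤ ∑ S' ∈ N,
          (if S ∪ S' ⊆ R then (if ∀ S' ∈ D, ¬ S' ⊆ R then (1 : ℝ) else 0) else 0) :=
        Finset.sum_nonneg fun S' _ => by split_ifs <;> norm_num
      by_cases hSR : S ⊆ R
      swap
      · simp only [hSR, if_false]; linarith
      by_cases hDR : ∀ S' ∈ D, ¬ S' ⊆ R
      swap
      · rw [if_neg hDR, if_pos hSR]
        split_ifs <;> simp
      by_cases hFR : ∀ S' ∈ F, ¬ S' ⊆ R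
      · simp only [if_pos hDR] at hsum
        rw [if_pos hSR, if_pos hDR, if_pos hSR, if_pos hFR]
        linarith
      · push Not at hFR
        obtain ⟨S', hS', hS'R⟩ := hFR
        have hmem : S' ∈ N := by
          rw [hN, Finset.mem_filter]
          exact ⟨hS', fun hd => hDR S' (Finset.mem_filter.2 ⟨hS', hd⟩) hS'R⟩
        have := Finset.single_le_sum (f := fun S' =>
          (if S ∪ S' ⊆ R then (if ∀ S' ∈ D, ¬ S' ⊆ R then (1 : ℝ) else 0) else 0))
          (fun S' _ => by split_ifs <;> norm_num) hmem
        rw [if_pos (Finset.union_subset hSR hS'R), if_pos hDR] at this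
        rw [if_pos hSR, if_pos hDR]
        have h3 : (0 : ℝ) ≤ if S ⊆ R then (if ∀ S' ∈ F, ¬ S' ⊆ R then 1 else 0) else 0 := by
          split_ifs <;> norm_num
        linarith
    have hmean := bernoulliMean_mono (V := V) h0 h1 hpt
    rw [bernoulliMean_sub, bernoulliMean_sum, bernoulliMean_superset hS] at hmean
    have hind : bernoulliMean p V (fun R => if ∀ S' ∈ D, ¬ S' ⊆ S ∪ R then (1 : ℝ) else 0) =
        avoidProb p V D := by
      unfold avoidProb
      congr 1
      funext R
      have : (∀ S' ∈ D, ¬ S' ⊆ S ∪ R) ↔ ∀ S' ∈ D, ¬ S' ⊆ R := by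
        refine forall₂_congr fun S' hS' => not_congr ?_
        have hd : Disjoint S S' := (Finset.mem_filter.1 hS').2
        exact ⟨fun h => hd.symm.left_le_of_le_sup_left h,
          fun h => h.trans Finset.subset_union_right⟩
      simp only [this]
    rw [hind] at hmean
    have hN' : ∑ S' ∈ N, bernoulliMean p V (fun R =>
        if S ∪ S' ⊆ R then (if ∀ S' ∈ D, ¬ S' ⊆ R then (1 : ℝ) else 0) else 0) ≤
        (∑ S' ∈ N, ∏ i ∈ S ∪ S', p i) * avoidProb p V D := by
      rw [Finset.sum_mul]
      refine Finset.sum_le_sum fun S' hS' => ?_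
      rw [bernoulliMean_superset
        (Finset.union_subset hS (hF S' (Finset.mem_filter.1 hS').1))]
      refine mul_le_mul_of_nonneg_left ?_ (Finset.prod_nonneg fun i _ => h0 i)
      refine bernoulliMean_mono h0 h1 fun R => ?_
      by_cases h : ∀ S'' ∈ D, ¬ S'' ⊆ S ∪ S' ∪ R
      · rw [if_pos h, if_pos fun S'' hS'' hR => h S'' hS'' (hR.trans Finset.subset_union_right)]
      · rw [if_neg h]; split_ifs <;> norm_num
    rw [hx, sub_mul]
    linarith
  rcases le_or_gt 0 x with hx0 | hx0
  · exact (mul_le_mul_of_nonneg_left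
      (avoidProb_anti h0 h1 (Finset.filter_subset _ _)) hx0).trans key
  · refine (mul_nonpos_of_nonpos_of_nonneg hx0.le (avoidProb_nonneg h0 h1 F)).trans ?_
    have := bernoulliMean_mono (V := V) h0 h1 (g := fun _ => 0)
      (h := fun R => if S ⊆ R then (if ∀ S' ∈ F, ¬ S' ⊆ R then 1 else 0) else 0)
      (fun R => by split_ifs <;> norm_num)
    simpa [bernoulliMean] using this

/-- **Janson's inequality**, with the sum over ordered overlapping pairs. -/
lemma avoidProb_le_exp (h0 : ∀ i, 0 ≤ p i) (h1 : ∀ i, p i ≤ 1) (F : Finset (Finset ι))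
    (hF : ∀ S ∈ F, S ⊆ V) :
    avoidProb p V F ≤ Real.exp (-(∑ S ∈ F, ∏ i ∈ S, p i) +
      ∑ q ∈ overlappingPairs F, ∏ i ∈ q.1 ∪ q.2, p i) := by
  induction F using Finset.induction_on with
  | empty => simp [avoidProb_empty, overlappingPairs]
  | insert S F hS ih =>
    set x := (∏ i ∈ S, p i) - ∑ S' ∈ F.filter (fun S' => ¬ Disjoint S S'), ∏ i ∈ S ∪ S', p i
      with hx
    have hstep := le_bernoulliMean_superset_avoid (V := V) h0 h1
      (hF S (Finset.mem_insert_self S F)) fun S' hS' => hF S' (Finset.mem_insert_of_mem hS')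
    have ih' := ih fun S' hS' => hF S' (Finset.mem_insert_of_mem hS')
    have hpairs : (∑ S' ∈ F.filter (fun S' => ¬ Disjoint S S'), ∏ i ∈ S ∪ S', p i) +
        ∑ q ∈ overlappingPairs F, ∏ i ∈ q.1 ∪ q.2, p i ≤
        ∑ q ∈ overlappingPairs (insert S F), ∏ i ∈ q.1 ∪ q.2, p i := by
      have him : ∑ S' ∈ F.filter (fun S' => ¬ Disjoint S S'), ∏ i ∈ S ∪ S', p i =
          ∑ q ∈ (F.filter (fun S' => ¬ Disjoint S S')).map ⟨fun S' => (S, S'),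
            fun _ _ h => (Prod.ext_iff.1 h).2⟩, ∏ i ∈ q.1 ∪ q.2, p i := by
        rw [Finset.sum_map]; rfl
      rw [him, ← Finset.sum_union]
      · refine Finset.sum_le_sum_of_subset_of_nonneg ?_
          fun q _ _ => Finset.prod_nonneg fun i _ => h0 i
        intro q hq
        rw [Finset.mem_union, Finset.mem_map] at hq
        rcases hq with ⟨S', hS', rfl⟩ | hq
        · rw [Finset.mem_filter] at hS'
          simp only [overlappingPairs, Finset.mem_filter, Finset.mem_product]
          exact ⟨⟨Finset.mem_insert_self _ _, Finset.mem_insert_of_mem hS'.1⟩,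
            fun h => hS ((show S = S' from h) ▸ hS'.1), hS'.2⟩
        · simp only [overlappingPairs, Finset.mem_filter, Finset.mem_product] at hq ⊢
          exact ⟨⟨Finset.mem_insert_of_mem hq.1.1, Finset.mem_insert_of_mem hq.1.2⟩, hq.2⟩
      · rw [Finset.disjoint_left]
        intro q hq hq'
        rw [Finset.mem_map] at hq
        obtain ⟨S', _, rfl⟩ := hq
        simp only [overlappingPairs, Finset.mem_filter, Finset.mem_product] at hq'
        exact hS hq'.1.1
    rw [avoidProb_insert, Finset.sum_insert hS]
    calc _ ≤ (1 - x) * avoidProb p V F := by linarith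
      _ ≤ Real.exp (-x) * avoidProb p V F :=
          mul_le_mul_of_nonneg_right (Real.one_sub_le_exp_neg x) (avoidProb_nonneg h0 h1 F)
      _ ≤ Real.exp (-x) * _ := mul_le_mul_of_nonneg_left ih' (Real.exp_pos _).le
      _ ≤ _ := by
          rw [← Real.exp_add]
          exact Real.exp_le_exp.2 (by linarith)

end Bernoulli

/-! ### The power series `(1 - X) ^ (-α)` -/

section Series

open PowerSeries

/-- The power series `(1 - X) ^ (-α)`. -/
noncomputable def negBinomialSeries (α : ℝ) : PowerSeries ℝ :=
  rescale (-1) (binomialSeries ℝ (-α))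

lemma negBinomialSeries_add (α β : ℝ) :
    negBinomialSeries (α + β) = negBinomialSeries α * negBinomialSeries β := by
  simp only [negBinomialSeries, neg_add, binomialSeries_add, map_mul]

lemma negBinomialSeries_pow (α : ℝ) (k : ℕ) :
    negBinomialSeries α ^ k = negBinomialSeries (k * α) := by
  induction k with
  | zero => simp [negBinomialSeries]
  | succ k ih => rw [pow_succ, ih, ← negBinomialSeries_add]; push_cast; ring_nf

lemma coeff_negBinomialSeries (α : ℝ) (n : ℕ) :
    coeff n (negBinomialSeries α) = ∏ i ∈ Finset.range n, (α + i) / (i + 1) := by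
  have h1 : coeff n (negBinomialSeries α) = Ring.multichoose α n := by
    rw [negBinomialSeries, coeff_rescale, binomialSeries_coeff, Ring.choose_neg,
      Ring.multichoose_eq, Int.negOnePow_def, smul_eq_mul, mul_one]
    simp only [zpow_natCast, Units.smul_def, Units.val_pow_eq_pow_val, Units.val_neg, Units.val_one,
      zsmul_eq_mul, Int.cast_pow, Int.cast_neg, Int.cast_one]
    rw [← mul_assoc, ← mul_pow]; simp
  have h2 := Ring.factorial_nsmul_multichoose_eq_ascPochhammer α n
  rw [Polynomial.ascPochhammer_smeval_eq_eval, ← h1, nsmul_eq_mul] at h2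
  have h3 : (ascPochhammer ℝ n).eval α =
      (n.factorial : ℝ) * ∏ i ∈ Finset.range n, (α + i) / (i + 1) := by
    clear h1 h2
    induction n with
    | zero => simp
    | succ n ih =>
      rw [ascPochhammer_succ_eval, ih, Finset.prod_range_succ, Nat.factorial_succ]
      push_cast
      field_simp
  rw [h3] at h2
  exact mul_left_cancel₀ (by positivity) h2

lemma coeff_negBinomialSeries_nonneg {α : ℝ} (hα : 0 ≤ α) (n : ℕ) :
    0 ≤ coeff n (negBinomialSeries α) := by
  rw [coeff_negBinomialSeries]
  exact Finset.prod_nonneg fun i _ => by positivity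

lemma coeff_negBinomialSeries_pos {α : ℝ} (hα : 0 < α) (n : ℕ) :
    0 < coeff n (negBinomialSeries α) := by
  rw [coeff_negBinomialSeries]
  exact Finset.prod_pos fun i _ => by positivity

lemma coeff_negBinomialSeries_one (n : ℕ) : coeff n (negBinomialSeries 1) = 1 := by
  rw [coeff_negBinomialSeries]
  refine Finset.prod_eq_one fun i _ => ?_
  rw [add_comm]
  exact div_self (by positivity)

lemma coeff_negBinomialSeries_le {α δ : ℝ} (hα : 0 ≤ α) (hδ : 0 ≤ δ) (hαδ : α + δ ≤ 1) (n : ℕ) :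
    coeff n (negBinomialSeries α) ≤ ((n : ℝ) + 1) ^ (-δ) := by
  rw [coeff_negBinomialSeries]
  induction n with
  | zero => simp
  | succ n ih =>
    rw [Finset.prod_range_succ]
    have hn : (0 : ℝ) < n + 1 := by positivity
    have hb : (α + n) / (n + 1) ≤ (((n : ℝ) + 1) / (n + 2)) ^ δ := by
      have h1 : (1 + 1 / ((n : ℝ) + 1)) ^ δ ≤ 1 + δ * (1 / ((n : ℝ) + 1)) :=
        rpow_one_add_le_one_add_mul_self
          (le_trans (by norm_num) (show (0 : ℝ) ≤ 1 / ((n : ℝ) + 1) by positivity)) hδ (by linarith)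
      have h2 : ((n : ℝ) + 1) / (n + 2) = (1 + 1 / ((n : ℝ) + 1))⁻¹ := by field_simp; ring
      rw [h2, Real.inv_rpow (by positivity)]
      refine le_trans ?_ (inv_anti₀ (by positivity) h1)
      rw [div_le_iff₀ hn, ← div_eq_inv_mul, le_div_iff₀ (by positivity)]
      have h3 : δ * (1 / ((n : ℝ) + 1)) * (n + 1) = δ := by field_simp
      have h4 : 0 ≤ δ * (1 / ((n : ℝ) + 1)) := by positivity
      nlinarith
    calc _ ≤ ((n : ℝ) + 1) ^ (-δ) * (((n : ℝ) + 1) / (n + 2)) ^ δ :=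
          mul_le_mul ih hb (by positivity) (by positivity)
      _ = (((n + 1 : ℕ) : ℝ) + 1) ^ (-δ) := by
          rw [Real.div_rpow hn.le (by positivity), Real.rpow_neg hn.le,
            Real.rpow_neg (by positivity)]
          push_cast
          rw [show (n : ℝ) + 1 + 1 = n + 2 by ring]
          have := (Real.rpow_pos_of_pos hn δ).ne'
          field_simp

lemma tendsto_rpow_div_coeff_negBinomialSeries {δ : ℝ} (hδ : 0 < δ) :
    Tendsto (fun n : ℕ => (n : ℝ) ^ (-1 + δ) / coeff n (negBinomialSeries δ)) atTop
      (nhds (Real.Gamma δ)) := by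
  have h1 : Tendsto (fun n : ℕ => 1 + δ / (n : ℝ)) atTop (nhds 1) := by
    simpa using (tendsto_const_div_atTop_nhds_zero_nat δ).const_add 1
  have h2 := (Real.GammaSeq_tendsto_Gamma δ).mul h1
  rw [mul_one] at h2
  refine h2.congr' ?_
  filter_upwards [eventually_gt_atTop 0] with n hn
  have hn' : (0 : ℝ) < n := by exact_mod_cast hn
  have hc := coeff_negBinomialSeries_pos hδ n
  have h3 : ∏ j ∈ Finset.range n, (δ + j) = n.factorial * coeff n (negBinomialSeries δ) := by
    rw [coeff_negBinomialSeries, ← Finset.prod_range_add_one_eq_factorial, Nat.cast_prod,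
      ← Finset.prod_mul_distrib]
    refine Finset.prod_congr rfl fun i _ => ?_
    push_cast
    field_simp
  rw [Real.GammaSeq, Finset.prod_range_succ, h3, Real.rpow_add hn', Real.rpow_neg_one]
  have h4 : δ + (n : ℝ) ≠ 0 := by positivity
  have h5 : (n.factorial : ℝ) ≠ 0 := by positivity
  field_simp
  ring

/-- Coefficientwise domination `|f| ≤ g` of power series. -/
def Dominated (f g : PowerSeries ℝ) : Prop := ∀ n, |coeff n f| ≤ coeff n g

lemma Dominated.coeff_nonneg {f g : PowerSeries ℝ} (h : Dominated f g) (n : ℕ) : 0 ≤ coeff n g :=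
  (abs_nonneg _).trans (h n)

lemma Dominated.mul {f g f' g' : PowerSeries ℝ} (h : Dominated f g) (h' : Dominated f' g') :
    Dominated (f * f') (g * g') := fun n => by
  rw [coeff_mul, coeff_mul]
  refine (Finset.abs_sum_le_sum_abs _ _).trans (Finset.sum_le_sum fun x _ => ?_)
  rw [abs_mul]
  exact mul_le_mul (h _) (h' _) (abs_nonneg _) (h.coeff_nonneg _)

lemma Dominated.pow {f g : PowerSeries ℝ} (h : Dominated f g) (k : ℕ) :
    Dominated (f ^ k) (g ^ k) := by
  induction k with
  | zero =>
    intro n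
    rw [pow_zero, pow_zero, coeff_one]
    split_ifs <;> simp
  | succ k ih => rw [pow_succ, pow_succ]; exact ih.mul h

lemma Dominated.sum {κ : Type*} {J : Finset κ} {f g : κ → PowerSeries ℝ}
    (h : ∀ j ∈ J, Dominated (f j) (g j)) : Dominated (∑ j ∈ J, f j) (∑ j ∈ J, g j) := fun n => by
  rw [map_sum, map_sum]
  exact (Finset.abs_sum_le_sum_abs _ _).trans (Finset.sum_le_sum fun j hj => h j hj n)

lemma dominated_self {f : PowerSeries ℝ} (h : ∀ n, 0 ≤ coeff n f) : Dominated f f :=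
  fun n => (abs_of_nonneg (h n)).le

lemma tendsto_coeff_mul_of_finite {h g : PowerSeries ℝ} {N : ℕ}
    (hh : ∀ n, N ≤ n → coeff n h = 0) (hg : Tendsto (fun n => coeff n g) atTop (nhds 0)) :
    Tendsto (fun n => coeff n (h * g)) atTop (nhds 0) := by
  have h1 : Tendsto (fun n => ∑ i ∈ Finset.range N, coeff i h * coeff (n - i) g) atTop
      (nhds (∑ i ∈ Finset.range N, coeff i h * 0)) :=
    tendsto_finsetSum _ fun i _ => (hg.comp (tendsto_sub_atTop_nat i)).const_mul _
  simp only [mul_zero, Finset.sum_const_zero] at h1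
  refine h1.congr' ?_
  filter_upwards [eventually_ge_atTop N] with n hn
  rw [coeff_mul, Finset.Nat.sum_antidiagonal_eq_sum_range_succ (fun i j => coeff i h * coeff j g)]
  refine Finset.sum_subset (fun i hi => ?_) fun i _ hi => ?_
  · rw [Finset.mem_range] at hi ⊢; omega
  · rw [Finset.mem_range, not_lt] at hi
    rw [hh i hi, zero_mul]

end Series

/-! ### Convolution powers of the membership probabilities -/

section MemProb

open PowerSeries

/-- The probability that `n` belongs to the random set; it vanishes at `n = 0`. -/
noncomputable def memProb (s n : ℕ) : ℝ := (1 / (s : ℝ)) * (n : ℝ) ^ (-1 + 1 / (s : ℝ))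

/-- The generating function of `memProb s`. -/
noncomputable def memSeries (s : ℕ) : PowerSeries ℝ := mk (memProb s)

variable {s : ℕ}

lemma one_div_le_half (hs : 2 ≤ s) : 1 / (s : ℝ) ≤ 1 / 2 :=
  one_div_le_one_div_of_le (by norm_num) (by exact_mod_cast hs)

lemma one_div_pos_of_two_le (hs : 2 ≤ s) : 0 < 1 / (s : ℝ) :=
  one_div_pos.2 (by exact_mod_cast (by omega : 0 < s))

lemma memProb_zero (hs : 2 ≤ s) : memProb s 0 = 0 := by
  have := one_div_le_half hs
  rw [memProb, Nat.cast_zero, Real.zero_rpow (by linarith), mul_zero]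

lemma memProb_nonneg (n : ℕ) : 0 ≤ memProb s n := by unfold memProb; positivity

lemma memProb_le_half (hs : 2 ≤ s) (n : ℕ) : memProb s n ≤ 1 / 2 := by
  rcases Nat.eq_zero_or_pos n with rfl | hn
  · rw [memProb_zero hs]; norm_num
  · have h := one_div_le_half hs
    have h1 : (n : ℝ) ^ (-1 + 1 / (s : ℝ)) ≤ 1 :=
      Real.rpow_le_one_of_one_le_of_nonpos (by exact_mod_cast hn) (by linarith)
    calc memProb s n ≤ 1 / (s : ℝ) * 1 :=
          mul_le_mul_of_nonneg_left h1 (one_div_pos_of_two_le hs).le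
      _ ≤ 1 / 2 := by linarith

lemma memProb_le_one (hs : 2 ≤ s) (n : ℕ) : memProb s n ≤ 1 :=
  (memProb_le_half hs n).trans (by norm_num)

lemma memProb_le_mul (hs : 2 ≤ s) {w : ℕ} (hw : 1 ≤ w) (hws : w ≤ s) (a : ℕ) :
    memProb s a ≤ s * memProb s (w * a) := by
  have hs0 : (0 : ℝ) < s := by exact_mod_cast (by omega : 0 < s)
  have hw0 : (1 : ℝ) ≤ w := by exact_mod_cast hw
  have hδ := one_div_pos_of_two_le hs
  have h1 : (1 : ℝ) ≤ s * (w : ℝ) ^ (-1 + 1 / (s : ℝ)) := by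
    have h2 : (w : ℝ) ^ (-1 : ℝ) ≤ (w : ℝ) ^ (-1 + 1 / (s : ℝ)) :=
      Real.rpow_le_rpow_of_exponent_le hw0 (by linarith)
    have h3 : (s : ℝ)⁻¹ ≤ (w : ℝ) ^ (-1 : ℝ) := by
      rw [Real.rpow_neg_one]
      exact inv_anti₀ (by linarith) (by exact_mod_cast hws)
    calc (1 : ℝ) = s * (s : ℝ)⁻¹ := (mul_inv_cancel₀ hs0.ne').symm
      _ ≤ _ := mul_le_mul_of_nonneg_left (h3.trans h2) hs0.le
  unfold memProb
  rw [Nat.cast_mul, Real.mul_rpow (by positivity) (by positivity)]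
  have h4 : 0 ≤ 1 / (s : ℝ) * (a : ℝ) ^ (-1 + 1 / (s : ℝ)) := by positivity
  nlinarith [mul_le_mul_of_nonneg_right h1 h4]

lemma tendsto_memProb_div (hs : 2 ≤ s) :
    Tendsto (fun n : ℕ => memProb s n / coeff n (negBinomialSeries (1 / (s : ℝ)))) atTop
      (nhds (Real.Gamma (1 / (s : ℝ)) / s)) := by
  have := (tendsto_rpow_div_coeff_negBinomialSeries (one_div_pos_of_two_le hs)).const_mul
    (1 / (s : ℝ))
  rw [one_div_mul_eq_div] at this
  refine this.congr fun n => ?_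
  rw [memProb, mul_div_assoc]

lemma exists_memProb_le (hs : 2 ≤ s) : ∃ K : ℝ, 1 ≤ K ∧ Dominated (memSeries s)
    (K • negBinomialSeries (1 / (s : ℝ))) := by
  obtain ⟨K, hK⟩ := (tendsto_memProb_div hs).bddAbove_range
  refine ⟨max K 1, le_max_right _ _, fun n => ?_⟩
  have hb := coeff_negBinomialSeries_pos (one_div_pos_of_two_le hs) n
  rw [memSeries, coeff_mk, abs_of_nonneg (memProb_nonneg n), coeff_smul, smul_eq_mul]
  rw [← div_le_iff₀ hb]
  exact (hK (Set.mem_range_self n)).trans (le_max_left _ _)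

lemma negBinomialSeries_pow_self (hs : 2 ≤ s) :
    negBinomialSeries (1 / (s : ℝ)) ^ s = negBinomialSeries 1 := by
  have hs0 : (s : ℝ) ≠ 0 := by exact_mod_cast (by omega : s ≠ 0)
  rw [negBinomialSeries_pow, mul_one_div_cancel hs0]

lemma coeff_negBinomialSeries_pow_le (hs : 2 ≤ s) {k : ℕ} (hk : k < s) (n : ℕ) :
    coeff n (negBinomialSeries (1 / (s : ℝ)) ^ k) ≤ ((n : ℝ) + 1) ^ (-(1 / (s : ℝ))) := by
  have hs0 : (0 : ℝ) < s := by exact_mod_cast (by omega : 0 < s)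
  have hδ := one_div_pos_of_two_le hs
  rw [negBinomialSeries_pow]
  refine coeff_negBinomialSeries_le (by positivity) hδ.le ?_ n
  have : (k : ℝ) + 1 ≤ s := by exact_mod_cast hk
  calc (k : ℝ) * (1 / s) + 1 / s = (k + 1) / s := by ring
    _ ≤ 1 := (div_le_one hs0).2 this

lemma coeff_memSeries_pow_nonneg (k n : ℕ) : 0 ≤ coeff n (memSeries s ^ k) :=
  ((dominated_self fun n => by rw [memSeries, coeff_mk]; exact memProb_nonneg n).pow k
    : Dominated (memSeries s ^ k) _).coeff_nonneg n

/-- Uniform bounds for the `k`-fold convolution powers of `memProb s`: polynomial decay for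
`k < s`, boundedness for `k = s`. -/
lemma exists_coeff_memSeries_pow_le (hs : 2 ≤ s) : ∃ K : ℝ, 1 ≤ K ∧
    (∀ k < s, ∀ n : ℕ, coeff n (memSeries s ^ k) ≤ K * ((n : ℝ) + 1) ^ (-(1 / (s : ℝ)))) ∧
    ∀ n : ℕ, coeff n (memSeries s ^ s) ≤ K := by
  obtain ⟨K, hK1, hK⟩ := exists_memProb_le hs
  have key : ∀ k ≤ s, ∀ n, coeff n (memSeries s ^ k) ≤
      K ^ s * coeff n (negBinomialSeries (1 / (s : ℝ)) ^ k) := by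
    intro k hk n
    have h1 := (le_abs_self _).trans (hK.pow k n)
    rw [smul_pow, coeff_smul, smul_eq_mul] at h1
    have h2 : 0 ≤ coeff n (negBinomialSeries (1 / (s : ℝ)) ^ k) := by
      rw [negBinomialSeries_pow]
      exact coeff_negBinomialSeries_nonneg (by positivity) n
    exact h1.trans (mul_le_mul_of_nonneg_right (pow_le_pow_right₀ hK1 hk) h2)
  refine ⟨K ^ s, one_le_pow₀ hK1, fun k hk n => (key k hk.le n).trans ?_,
    fun n => (key s le_rfl n).trans ?_⟩
  · exact mul_le_mul_of_nonneg_left (coeff_negBinomialSeries_pow_le hs hk n) (by positivity)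
  · rw [negBinomialSeries_pow_self hs, coeff_negBinomialSeries_one, mul_one]

/-- The expected number of ordered representations of `n` as a sum of `s` elements converges. -/
lemma tendsto_coeff_memSeries_pow (hs : 2 ≤ s) :
    Tendsto (fun n => coeff n (memSeries s ^ s)) atTop
      (nhds ((Real.Gamma (1 / (s : ℝ)) / s) ^ s)) := by
  have hs0 : (0 : ℝ) < s := by exact_mod_cast (by omega : 0 < s)
  have hδ := one_div_pos_of_two_le hs
  set G := negBinomialSeries (1 / (s : ℝ)) with hG
  set κ := Real.Gamma (1 / (s : ℝ)) / s with hκ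
  have hκ0 : 0 < κ := div_pos (Real.Gamma_pos_of_pos hδ) hs0
  have hGpos : ∀ n, 0 < coeff n G := coeff_negBinomialSeries_pos hδ
  obtain ⟨K, hK1, hK⟩ := exists_memProb_le hs
  set L := K + κ with hL
  have hL0 : 0 < L := by linarith
  have hFL : Dominated (memSeries s) (L • G) := fun n => by
    refine (hK n).trans ?_
    rw [coeff_smul, coeff_smul, smul_eq_mul, smul_eq_mul]
    exact mul_le_mul_of_nonneg_right (by linarith) (hGpos n).le
  have hGL : Dominated (κ • G) (L • G) := fun n => by
    rw [coeff_smul, coeff_smul, smul_eq_mul, smul_eq_mul, abs_of_pos (mul_pos hκ0 (hGpos n))]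
    exact mul_le_mul_of_nonneg_right (by linarith) (hGpos n).le
  have hlim : Tendsto (fun n => coeff n (G ^ (s - 1))) atTop (nhds 0) := by
    have h1 : Tendsto (fun n : ℕ => ((n : ℝ) + 1) ^ (-(1 / (s : ℝ)))) atTop (nhds 0) :=
      (tendsto_rpow_neg_atTop hδ).comp
        (tendsto_atTop_add_const_right _ _ tendsto_natCast_atTop_atTop)
    refine squeeze_zero (fun n => ?_) (fun n => ?_) h1
    · rw [hG, negBinomialSeries_pow]
      exact coeff_negBinomialSeries_nonneg (by positivity) n
    · exact coeff_negBinomialSeries_pow_le hs (by omega) n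
  rw [Metric.tendsto_atTop]
  intro η hη
  set M : ℝ := s * L ^ (s - 1) with hM
  have hM0 : 0 < M := by positivity
  set ε := η / (2 * M) with hε
  have hε0 : 0 < ε := by positivity
  obtain ⟨N, hN⟩ := (Metric.tendsto_atTop.1 (tendsto_memProb_div hs)) ε hε0
  set H : PowerSeries ℝ := mk fun n => if n < N then (L + κ) * coeff n G else 0 with hH
  -- `H` absorbs the finitely many coefficients before the asymptotics set in.
  have hE : Dominated (memSeries s - κ • G) (ε • G + H) := by
    intro n
    rw [map_sub, map_add, coeff_smul, coeff_smul, smul_eq_mul, smul_eq_mul, hH, coeff_mk]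
    have hg := hGpos n
    by_cases hn : n < N
    · rw [if_pos hn]
      have h1 := hFL n
      rw [coeff_smul, smul_eq_mul] at h1
      have h2 := abs_sub (coeff n (memSeries s)) (κ * coeff n G)
      rw [abs_of_pos (mul_pos hκ0 hg)] at h2
      have := mul_pos hε0 hg
      linarith
    · rw [if_neg hn, add_zero]
      have h1 := hN n (not_lt.1 hn)
      rw [Real.dist_eq] at h1
      have h2 : coeff n (memSeries s) - κ * coeff n G =
          (memProb s n / coeff n G - κ) * coeff n G := by
        rw [memSeries, coeff_mk]; field_simp
      rw [h2, abs_mul, abs_of_pos hg]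
      exact mul_le_mul_of_nonneg_right h1.le hg.le
  -- Factor `F ^ s - (κ G) ^ s` through `F - κ G`; every other factor is dominated by `L G`.
  have hdiff : Dominated (memSeries s ^ s - (κ • G) ^ s) (M • (G ^ (s - 1) * (ε • G + H))) := by
    have h1 : Dominated (∑ i ∈ Finset.range s, memSeries s ^ i * (κ • G) ^ (s - 1 - i))
        (∑ i ∈ Finset.range s, (L • G) ^ i * (L • G) ^ (s - 1 - i)) :=
      Dominated.sum fun i _ => (hFL.pow i).mul (hGL.pow _)
    have h2 : ∑ i ∈ Finset.range s, (L • G) ^ i * (L • G) ^ (s - 1 - i) = M • G ^ (s - 1) := by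
      rw [Finset.sum_congr rfl (g := fun _ => (L • G) ^ (s - 1))]
      · rw [Finset.sum_const, Finset.card_range, smul_pow, hM, mul_smul, Nat.cast_smul_eq_nsmul]
      · intro i hi
        rw [← pow_add]
        congr 1
        have := Finset.mem_range.1 hi
        omega
    rw [h2] at h1
    have h3 := h1.mul hE
    rw [(Commute.all (memSeries s) (κ • G)).geom_sum₂_mul, smul_mul_assoc] at h3
    exact h3
  have hHlim : Tendsto (fun n => coeff n (H * G ^ (s - 1))) atTop (nhds 0) :=
    tendsto_coeff_mul_of_finite (N := N)
      (fun n hn => by rw [hH, coeff_mk, if_neg (not_lt.2 hn)]) hlim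
  obtain ⟨N', hN'⟩ := (Metric.tendsto_atTop.1 hHlim) ε hε0
  refine ⟨N', fun n hn => ?_⟩
  have hGs : G ^ s = negBinomialSeries 1 := negBinomialSeries_pow_self hs
  have h1 := hdiff n
  have h2 : G ^ (s - 1) * (ε • G + H) = ε • G ^ s + H * G ^ (s - 1) := by
    rw [mul_add, mul_smul_comm, ← pow_succ, Nat.sub_add_cancel (by omega), mul_comm H]
  rw [h2, smul_pow, map_sub, coeff_smul, coeff_smul, map_add, coeff_smul, hGs,
    coeff_negBinomialSeries_one] at h1
  simp only [smul_eq_mul, mul_one] at h1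
  have h3 := hN' n hn
  rw [Real.dist_eq, sub_zero] at h3
  have h4 := (le_abs_self _).trans_lt h3
  rw [Real.dist_eq]
  calc _ ≤ _ := h1
    _ < M * (ε + ε) := mul_lt_mul_of_pos_left (by linarith) hM0
    _ = η := by rw [hε]; field_simp; ring

end MemProb

/-! ### Expected numbers of representations -/

section Representations

open PowerSeries

variable {s : ℕ}

lemma coeff_memSeries_pow_card {ι : Type*} [DecidableEq ι] (J : Finset ι) (m : ℕ) :
    coeff m (memSeries s ^ J.card) = ∑ t ∈ J.piAntidiag m, ∏ j ∈ J, memProb s (t j) := by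
  rw [← Finset.prod_const, coeff_prod]
  refine Finset.sum_bij' (fun l _ => (l : ι → ℕ))
    (fun t ht => Finsupp.onFinset J t (Finset.mem_piAntidiag.1 ht).2) ?_ ?_ ?_ ?_ ?_
  · intro l hl
    rw [Finset.mem_finsuppAntidiag] at hl
    exact Finset.mem_piAntidiag.2 ⟨hl.1, fun i hi => hl.2 (Finsupp.mem_support_iff.2 hi)⟩
  · intro t ht
    rw [Finset.mem_finsuppAntidiag]
    exact ⟨(Finset.mem_piAntidiag.1 ht).1, Finsupp.support_onFinset_subset⟩
  · intro l hl
    ext i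
    rfl
  · intro t ht
    rfl
  · intro l hl
    simp only [memSeries, coeff_mk]

/-- The sets of `k` natural numbers with sum `m`. -/
def repSets (k m : ℕ) : Finset (Finset ℕ) :=
  (Finset.range (m + 1)).powerset.filter fun S => S.card = k ∧ ∑ i ∈ S, i = m

lemma mem_repSets {k m : ℕ} {S : Finset ℕ} :
    S ∈ repSets k m ↔ S.card = k ∧ ∑ i ∈ S, i = m := by
  rw [repSets, Finset.mem_filter, Finset.mem_powerset, and_iff_right_iff_imp]
  rintro ⟨-, h⟩ i hi
  rw [Finset.mem_range, Nat.lt_succ_iff, ← h]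
  exact Finset.single_le_sum (f := fun i => i) (fun _ _ => Nat.zero_le _) hi

/-- The expected number of `k`-element subsets of the random set with sum `m`. -/
noncomputable def repMean (s k m : ℕ) : ℝ := ∑ S ∈ repSets k m, ∏ i ∈ S, memProb s i

lemma repMean_nonneg (k m : ℕ) : 0 ≤ repMean s k m :=
  Finset.sum_nonneg fun _ _ => Finset.prod_nonneg fun i _ => memProb_nonneg i

/-- A set with `k` elements has `k!` enumerations by injective tuples. -/
lemma card_enumerations {k : ℕ} {S : Finset ℕ} (hS : S.card = k) :
    (((Finset.univ : Finset (Fin k)).piAntidiag (∑ i ∈ S, i)).filter fun t =>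
      Function.Injective t ∧ Finset.univ.image t = S).card = k.factorial := by
  have hcard : Fintype.card (Fin k ≃ S) = k.factorial := by
    rw [Fintype.card_equiv ((S.equivFinOfCardEq hS).symm), Fintype.card_fin]
  rw [← hcard, ← Finset.card_univ]
  symm
  refine Finset.card_bij (fun e _ => fun j => (e j : ℕ)) ?_ ?_ ?_
  · intro e _
    have hinj : Function.Injective fun j => (e j : ℕ) :=
      Subtype.val_injective.comp e.injective
    have him : Finset.univ.image (fun j => (e j : ℕ)) = S := by
      ext a
      simp only [Finset.mem_image, Finset.mem_univ, true_and]
      exact ⟨fun ⟨j, hj⟩ => hj ▸ (e j).2, fun ha => ⟨e.symm ⟨a, ha⟩, by simp⟩⟩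
    rw [Finset.mem_filter, Finset.mem_piAntidiag]
    refine ⟨⟨?_, fun _ _ => Finset.mem_univ _⟩, hinj, him⟩
    have hsum := Finset.sum_image (s := Finset.univ) (f := fun i : ℕ => i) hinj.injOn
    rw [him] at hsum
    exact hsum.symm
  · intro e _ e' _ h
    ext j
    exact congrFun h j
  · intro t ht
    rw [Finset.mem_filter] at ht
    obtain ⟨-, hinj, him⟩ := ht
    have hmem : ∀ j, t j ∈ S := fun j => him ▸ Finset.mem_image_of_mem t (Finset.mem_univ j)
    refine ⟨Equiv.ofBijective (fun j => (⟨t j, hmem j⟩ : S)) ⟨fun i j h => hinj (by simpa using h),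
      fun a => ?_⟩, Finset.mem_univ _, rfl⟩
    have ha : (a : ℕ) ∈ Finset.univ.image t := him ▸ a.2
    obtain ⟨j, -, hj⟩ := Finset.mem_image.1 ha
    exact ⟨j, Subtype.ext hj⟩

/-- Each `k`-element set arises from exactly `k!` injective tuples. -/
lemma sum_injective_eq (k m : ℕ) :
    ∑ t ∈ ((Finset.univ : Finset (Fin k)).piAntidiag m).filter fun t => Function.Injective t,
      ∏ j, memProb s (t j) = k.factorial * repMean s k m := by
  rw [← Finset.sum_fiberwise_of_maps_to (t := repSets k m)
    (g := fun t : Fin k → ℕ => Finset.univ.image t), repMean, Finset.mul_sum]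
  · refine Finset.sum_congr rfl fun S hS => ?_
    rw [mem_repSets] at hS
    obtain ⟨hc, hm⟩ := hS
    rw [Finset.filter_filter, ← card_enumerations hc, hm, ← nsmul_eq_mul, ← Finset.sum_const]
    refine Finset.sum_congr rfl fun t ht => ?_
    obtain ⟨-, hinj, him⟩ := Finset.mem_filter.1 ht
    rw [← him, Finset.prod_image hinj.injOn]
  · intro t ht
    rw [Finset.mem_filter, Finset.mem_piAntidiag] at ht
    rw [mem_repSets, Finset.card_image_of_injective _ ht.2, Finset.sum_image ht.2.injOn]
    exact ⟨by simp, ht.1.1⟩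

lemma coeff_memSeries_pow_eq (k m : ℕ) :
    coeff m (memSeries s ^ k) = k.factorial * repMean s k m +
      ∑ t ∈ ((Finset.univ : Finset (Fin k)).piAntidiag m).filter fun t => ¬ Function.Injective t,
        ∏ j, memProb s (t j) := by
  have h := coeff_memSeries_pow_card (s := s) (Finset.univ : Finset (Fin k)) m
  rw [Finset.card_univ, Fintype.card_fin] at h
  rw [h, ← sum_injective_eq, Finset.sum_filter_add_sum_filter_not]

lemma repMean_le_coeff (k m : ℕ) : repMean s k m ≤ coeff m (memSeries s ^ k) := by
  rw [coeff_memSeries_pow_eq]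
  have h1 : 0 ≤ ∑ t ∈ ((Finset.univ : Finset (Fin k)).piAntidiag m).filter
      fun t => ¬ Function.Injective t, ∏ j, memProb s (t j) :=
    Finset.sum_nonneg fun _ _ => Finset.prod_nonneg fun i _ => memProb_nonneg _
  have h2 : (1 : ℝ) ≤ k.factorial := by exact_mod_cast Nat.one_le_iff_ne_zero.2 k.factorial_ne_zero
  have h3 := repMean_nonneg (s := s) k m
  nlinarith

/-- The expected number of degenerate representations with a prescribed coincidence pattern.
The pattern is the idempotent map `r` sending each index to a fixed index carrying the same value;
merging equal summands `t j` into the single summand `w j * t j` maps these representations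
injectively to representations with fewer summands. -/
lemma sum_pattern_le (hs : 2 ≤ s) (m : ℕ) (r : Fin s → Fin s) :
    ∑ t ∈ ((Finset.univ : Finset (Fin s)).piAntidiag m).filter
        (fun t => (∀ i, t (r i) = t i) ∧ ∀ i j, t i = t j → r i = r j),
      ∏ a ∈ Finset.univ.image t, memProb s a ≤
    (s : ℝ) ^ s * coeff m (memSeries s ^ (Finset.univ.image r).card) := by
  have hs1 : (1 : ℝ) ≤ s := by exact_mod_cast (by omega : 1 ≤ s)
  set J := Finset.univ.image r with hJ
  set w : Fin s → ℕ := fun j => (Finset.univ.filter fun i => r i = j).card with hw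
  have hw1 : ∀ j ∈ J, 1 ≤ w j := by
    intro j hj
    obtain ⟨i, -, hi⟩ := Finset.mem_image.1 hj
    exact Finset.card_pos.2 ⟨i, Finset.mem_filter.2 ⟨Finset.mem_univ _, hi⟩⟩
  have hws : ∀ j, w j ≤ s := fun j => (Finset.card_filter_le _ _).trans (by simp)
  set φ : (Fin s → ℕ) → Fin s → ℕ := fun t j => w j * t j with hφ
  set X := ((Finset.univ : Finset (Fin s)).piAntidiag m).filter
    (fun t => (∀ i, t (r i) = t i) ∧ ∀ i j, t i = t j → r i = r j) with hX
  have hterm : ∀ t ∈ X, ∏ a ∈ Finset.univ.image t, memProb s a ≤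
      (s : ℝ) ^ s * ∏ j ∈ J, memProb s (φ t j) := by
    intro t ht
    obtain ⟨-, h1, h2⟩ := Finset.mem_filter.1 ht
    have him : Finset.univ.image t = J.image t := by
      rw [hJ, Finset.image_image]
      exact Finset.image_congr fun i _ => (h1 i).symm
    have hinj : Set.InjOn t J := by
      intro x hx y hy hxy
      obtain ⟨i, -, rfl⟩ := Finset.mem_image.1 hx
      obtain ⟨j, -, rfl⟩ := Finset.mem_image.1 hy
      rw [h1, h1] at hxy
      exact h2 i j hxy
    rw [him, Finset.prod_image hinj]
    calc ∏ j ∈ J, memProb s (t j) ≤ ∏ j ∈ J, ((s : ℝ) * memProb s (φ t j)) :=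
          Finset.prod_le_prod (fun j _ => memProb_nonneg _)
            fun j hj => memProb_le_mul hs (hw1 j hj) (hws j) (t j)
      _ = (s : ℝ) ^ J.card * ∏ j ∈ J, memProb s (φ t j) := by
          rw [Finset.prod_mul_distrib, Finset.prod_const]
      _ ≤ _ := by
          refine mul_le_mul_of_nonneg_right (pow_le_pow_right₀ hs1 ?_)
            (Finset.prod_nonneg fun j _ => memProb_nonneg _)
          exact Finset.card_image_le.trans (by simp)
  refine (Finset.sum_le_sum hterm).trans ?_
  rw [← Finset.mul_sum, coeff_memSeries_pow_card]
  refine mul_le_mul_of_nonneg_left ?_ (by positivity)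
  have hφinj : Set.InjOn φ X := by
    intro t ht t' ht' h
    obtain ⟨-, h1, -⟩ := Finset.mem_filter.1 ht
    obtain ⟨-, h1', -⟩ := Finset.mem_filter.1 ht'
    funext i
    rw [← h1, ← h1']
    have h3 := congrFun h (r i)
    exact Nat.eq_of_mul_eq_mul_left (hw1 (r i) (Finset.mem_image_of_mem r (Finset.mem_univ i))) h3
  rw [← Finset.sum_image (f := fun b => ∏ j ∈ J, memProb s (b j)) hφinj]
  refine Finset.sum_le_sum_of_subset_of_nonneg ?_
    fun _ _ _ => Finset.prod_nonneg fun j _ => memProb_nonneg _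
  intro b hb
  obtain ⟨t, ht, rfl⟩ := Finset.mem_image.1 hb
  obtain ⟨ht0, h1, -⟩ := Finset.mem_filter.1 ht
  rw [Finset.mem_piAntidiag] at ht0 ⊢
  refine ⟨?_, fun j hj => ?_⟩
  · have h3 := Finset.sum_fiberwise_of_maps_to (s := Finset.univ) (t := J) (g := r)
      (fun i _ => Finset.mem_image_of_mem r (Finset.mem_univ i)) (fun i => t i)
    rw [← ht0.1, ← h3]
    refine Finset.sum_congr rfl fun j hj => ?_
    rw [Finset.sum_congr rfl (g := fun _ => t j), Finset.sum_const, smul_eq_mul]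
    intro i hi
    rw [← h1 i, (Finset.mem_filter.1 hi).2]
  · by_contra hjJ
    refine hj ?_
    have : w j = 0 := Finset.card_eq_zero.2 (Finset.filter_eq_empty_iff.2 fun i _ hi =>
      hjJ (hi ▸ Finset.mem_image_of_mem r (Finset.mem_univ i)))
    simp [hφ, this]

/-- The expected number of representations with a repeated summand tends to zero polynomially. -/
lemma exists_sum_not_injective_le (hs : 2 ≤ s) : ∃ K : ℝ, 0 < K ∧ ∀ m : ℕ,
    ∑ t ∈ ((Finset.univ : Finset (Fin s)).piAntidiag m).filter fun t => ¬ Function.Injective t,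
      ∏ a ∈ Finset.univ.image t, memProb s a ≤ K * ((m : ℝ) + 1) ^ (-(1 / (s : ℝ))) := by
  have : NeZero s := ⟨by omega⟩
  obtain ⟨K, hK1, hK, -⟩ := exists_coeff_memSeries_pow_le hs
  have hs0 : (0 : ℝ) < s := by exact_mod_cast (by omega : 0 < s)
  refine ⟨Fintype.card (Fin s → Fin s) * ((s : ℝ) ^ s * K), by positivity, fun m => ?_⟩
  rw [← Finset.sum_fiberwise_of_maps_to
    (t := (Finset.univ : Finset (Fin s → Fin s)))
    (g := fun t : Fin s → ℕ => fun i => Function.invFun t (t i)) (fun _ _ => Finset.mem_univ _),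
    mul_assoc, ← nsmul_eq_mul, ← Finset.card_univ, ← Finset.sum_const]
  refine Finset.sum_le_sum fun r _ => ?_
  by_cases hr : Function.Injective r
  · rw [Finset.sum_eq_zero]
    · positivity
    · intro t ht
      exfalso
      rw [Finset.filter_filter, Finset.mem_filter] at ht
      obtain ⟨-, hninj, rfl⟩ := ht
      exact hninj fun i j hij => hr (by simp only [hij])
  · have hcard : (Finset.univ.image r).card < s := by
      refine lt_of_le_of_ne (Finset.card_image_le.trans (by simp)) fun h => hr ?_
      rw [← Set.injOn_univ, ← Finset.coe_univ, ← Finset.card_image_iff, h]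
      simp
    calc _ ≤ _ := Finset.sum_le_sum_of_subset_of_nonneg ?_
          fun _ _ _ => Finset.prod_nonneg fun j _ => memProb_nonneg _
      _ ≤ _ := sum_pattern_le hs m r
      _ ≤ _ := by
          rw [mul_assoc]
          exact mul_le_mul_of_nonneg_left (hK _ hcard m) (by positivity)
    intro t ht
    rw [Finset.filter_filter, Finset.mem_filter] at ht
    obtain ⟨ht0, -, rfl⟩ := ht
    refine Finset.mem_filter.2 ⟨ht0, fun i => Function.invFun_eq ⟨i, rfl⟩, fun i j hij => ?_⟩
    simp only [hij]

lemma prod_memProb_le_prod_image (hs : 2 ≤ s) {k : ℕ} (t : Fin k → ℕ) :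
    ∏ j, memProb s (t j) ≤ ∏ a ∈ Finset.univ.image t, memProb s a := by
  rw [Finset.prod_comp (memProb s) t]
  refine Finset.prod_le_prod (fun a _ => pow_nonneg (memProb_nonneg a) _) fun a ha => ?_
  refine pow_le_of_le_one (memProb_nonneg a) (memProb_le_one hs a) ?_
  obtain ⟨j, -, hj⟩ := Finset.mem_image.1 ha
  exact (Finset.card_pos.2 ⟨j, Finset.mem_filter.2 ⟨Finset.mem_univ _, hj⟩⟩).ne'

lemma tendsto_rpow_neg_add_one (hs : 2 ≤ s) :
    Tendsto (fun n : ℕ => ((n : ℝ) + 1) ^ (-(1 / (s : ℝ)))) atTop (nhds 0) :=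
  (tendsto_rpow_neg_atTop (one_div_pos_of_two_le hs)).comp
    (tendsto_atTop_add_const_right _ _ tendsto_natCast_atTop_atTop)

lemma tendsto_repMean (hs : 2 ≤ s) :
    Tendsto (fun m => repMean s s m) atTop (nhds (poissonParam s)) := by
  obtain ⟨K, hK0, hK⟩ := exists_sum_not_injective_le hs
  have h1 : Tendsto (fun m => ∑ t ∈ ((Finset.univ : Finset (Fin s)).piAntidiag m).filter
      fun t => ¬ Function.Injective t, ∏ j, memProb s (t j)) atTop (nhds 0) := by
    have h0 := (tendsto_rpow_neg_add_one hs).const_mul K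
    rw [mul_zero] at h0
    refine squeeze_zero (fun m => Finset.sum_nonneg fun _ _ => Finset.prod_nonneg fun i _ =>
      memProb_nonneg _) (fun m => (Finset.sum_le_sum fun t _ => ?_).trans (hK m)) h0
    exact prod_memProb_le_prod_image hs t
  have h2 := ((tendsto_coeff_memSeries_pow hs).sub h1).div_const (s.factorial : ℝ)
  have h3 : ((Real.Gamma (1 / (s : ℝ)) / s) ^ s - 0) / (s.factorial : ℝ) = poissonParam s := by
    rw [sub_zero, div_pow, div_div, poissonParam]
  rw [h3] at h2
  refine h2.congr fun m => ?_
  have : (s.factorial : ℝ) ≠ 0 := by positivity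
  rw [coeff_memSeries_pow_eq, add_sub_cancel_right, mul_div_cancel_left₀ _ this]

end Representations

/-! ### Overlapping representations -/

section Avoid

open PowerSeries

variable {s : ℕ}

/-- The `s`-element sets whose sum lies in `T`. -/
def distinctFamily (s : ℕ) (T : Finset ℕ) : Finset (Finset ℕ) := T.biUnion (repSets s)

/-- The supports of all `s`-tuples, repetitions allowed, whose sum lies in `T`. -/
def supportFamily (s : ℕ) (T : Finset ℕ) : Finset (Finset ℕ) :=
  T.biUnion fun m => ((Finset.univ : Finset (Fin s)).piAntidiag m).image
    fun t => Finset.univ.image t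

lemma mem_distinctFamily {T : Finset ℕ} {S : Finset ℕ} :
    S ∈ distinctFamily s T ↔ S.card = s ∧ ∑ i ∈ S, i ∈ T := by
  simp [distinctFamily, mem_repSets, and_comm]

lemma mem_supportFamily {T : Finset ℕ} {S : Finset ℕ} :
    S ∈ supportFamily s T ↔ ∃ t : Fin s → ℕ, ∑ j, t j ∈ T ∧ Finset.univ.image t = S := by
  simp only [supportFamily, Finset.mem_biUnion, Finset.mem_image, Finset.mem_piAntidiag]
  constructor
  · rintro ⟨m, hm, t, ⟨rfl, -⟩, rfl⟩
    exact ⟨t, hm, rfl⟩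
  · rintro ⟨t, ht, rfl⟩
    exact ⟨_, ht, t, ⟨rfl, fun _ _ => Finset.mem_univ _⟩, rfl⟩

lemma distinctFamily_subset_supportFamily (T : Finset ℕ) :
    distinctFamily s T ⊆ supportFamily s T := by
  intro S hS
  rw [mem_distinctFamily] at hS
  rw [mem_supportFamily]
  set e := S.equivFinOfCardEq hS.1
  have hinj : Function.Injective fun j => (e.symm j : ℕ) :=
    Subtype.val_injective.comp e.symm.injective
  have him : Finset.univ.image (fun j => (e.symm j : ℕ)) = S := by
    ext a
    simp only [Finset.mem_image, Finset.mem_univ, true_and]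
    exact ⟨fun ⟨j, hj⟩ => hj ▸ (e.symm j).2, fun ha => ⟨e ⟨a, ha⟩, by simp⟩⟩
  refine ⟨fun j => (e.symm j : ℕ), ?_, him⟩
  have hsum := Finset.sum_image (s := Finset.univ) (f := fun i : ℕ => i) hinj.injOn
  rw [him] at hsum
  rw [← hsum]
  exact hS.2

lemma sum_distinctFamily (T : Finset ℕ) :
    ∑ S ∈ distinctFamily s T, ∏ i ∈ S, memProb s i = ∑ m ∈ T, repMean s s m := by
  rw [distinctFamily, Finset.sum_biUnion]
  · rfl
  · intro m _ m' _ hne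
    rw [Function.onFun, Finset.disjoint_left]
    intro S hS hS'
    rw [mem_repSets] at hS hS'
    exact hne (hS.2.symm.trans hS'.2)

lemma sum_overlap_fiber_le {k m m' j : ℕ} (Q : Finset (Finset ℕ × Finset ℕ))
    (hQ : ∀ q ∈ Q, (q.1.card = s ∧ ∑ i ∈ q.1, i = m) ∧ (q.2.card = s ∧ ∑ i ∈ q.2, i = m') ∧
      (q.1 ∩ q.2).card = k ∧ ∑ i ∈ q.1 ∩ q.2, i = j) :
    ∑ q ∈ Q, ∏ i ∈ q.1 ∪ q.2, memProb s i ≤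
      repMean s k j * repMean s (s - k) (m - j) * repMean s (s - k) (m' - j) := by
  set φ : Finset ℕ × Finset ℕ → (Finset ℕ × Finset ℕ) × Finset ℕ :=
    fun q => ((q.1 ∩ q.2, q.1 \ q.2), q.2 \ q.1) with hφ
  have hsplit : ∀ q : Finset ℕ × Finset ℕ, ∏ i ∈ q.1 ∪ q.2, memProb s i =
      (∏ i ∈ (φ q).1.1, memProb s i) * (∏ i ∈ (φ q).1.2, memProb s i) *
        ∏ i ∈ (φ q).2, memProb s i := by
    intro q
    rw [← Finset.union_sdiff_self_eq_union, Finset.prod_union Finset.disjoint_sdiff,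
      ← Finset.prod_inter_mul_prod_sdiff q.1 q.2]
  have hinj : Function.Injective φ := by
    intro q q' h
    simp only [hφ, Prod.mk.injEq] at h
    obtain ⟨⟨h1, h2⟩, h3⟩ := h
    refine Prod.ext ?_ ?_
    · rw [← Finset.sdiff_union_inter q.1 q.2, h1, h2, Finset.sdiff_union_inter]
    · rw [← Finset.sdiff_union_inter q.2 q.1, Finset.inter_comm, h1, h3, Finset.inter_comm,
        Finset.sdiff_union_inter]
  rw [repMean, repMean, repMean, Finset.sum_mul_sum, ← Finset.sum_product', Finset.sum_mul_sum,
    ← Finset.sum_product']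
  simp only [hsplit]
  rw [← Finset.sum_image (s := Q) (g := φ) (f := fun x : (Finset ℕ × Finset ℕ) × Finset ℕ =>
    (∏ i ∈ x.1.1, memProb s i) * (∏ i ∈ x.1.2, memProb s i) * ∏ i ∈ x.2, memProb s i) hinj.injOn]
  refine Finset.sum_le_sum_of_subset_of_nonneg ?_ fun x _ _ =>
    mul_nonneg (mul_nonneg (Finset.prod_nonneg fun i _ => memProb_nonneg i)
      (Finset.prod_nonneg fun i _ => memProb_nonneg i))
      (Finset.prod_nonneg fun i _ => memProb_nonneg i)
  intro x hx
  obtain ⟨q, hq, rfl⟩ := Finset.mem_image.1 hx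
  obtain ⟨⟨h1, h2⟩, ⟨h3, h4⟩, h5, h6⟩ := hQ q hq
  have e1 := Finset.card_sdiff_add_card_inter q.1 q.2
  have e2 := Finset.card_sdiff_add_card_inter q.2 q.1
  have e3 := Finset.sum_inter_add_sum_sdiff q.1 q.2 (fun i => i)
  have e4 := Finset.sum_inter_add_sum_sdiff q.2 q.1 (fun i => i)
  rw [Finset.inter_comm] at e2 e4
  simp only [hφ, Finset.mem_product, mem_repSets]
  refine ⟨⟨⟨h5, h6⟩, ?_, ?_⟩, ?_, ?_⟩ <;> omega

/-- The triple convolution that controls pairs of representations sharing `k` summands. Either the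
common part leaves a remainder `m - j ≥ B`, which makes one factor small, or the common part itself
is large, and there are at most `B` such values of its sum. -/
lemma sum_triple_le (hs : 2 ≤ s) {K : ℝ} (hK1 : 1 ≤ K)
    (hK : ∀ k < s, ∀ n : ℕ, coeff n (memSeries s ^ k) ≤ K * ((n : ℝ) + 1) ^ (-(1 / (s : ℝ))))
    (hKs : ∀ n : ℕ, coeff n (memSeries s ^ s) ≤ K) {k : ℕ} (hk1 : 1 ≤ k) (hks : k < s)
    (m m' B : ℕ) (hB : 2 * B ≤ m) :
    ∑ j ∈ (Finset.range (m' + 1)).filter (· ≤ m),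
      repMean s k j * repMean s (s - k) (m - j) * repMean s (s - k) (m' - j) ≤
    K ^ 2 * ((B : ℝ) + 1) ^ (-(1 / (s : ℝ))) +
      B * (K ^ 3 * (((m : ℝ) + 1) / 2) ^ (-(1 / (s : ℝ)))) := by
  have hδ := one_div_pos_of_two_le hs
  set δ := 1 / (s : ℝ) with hδdef
  have hK0 : (0 : ℝ) ≤ K := by linarith
  have hle : ∀ n, repMean s (s - k) n ≤ K * ((n : ℝ) + 1) ^ (-δ) := fun n =>
    (repMean_le_coeff _ _).trans (hK _ (by omega) n)
  have hleK : ∀ n, repMean s (s - k) n ≤ K := fun n => by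
    refine (hle n).trans (mul_le_of_le_one_right hK0 ?_)
    exact Real.rpow_le_one_of_one_le_of_nonpos (by simp) (by linarith)
  have hrp : ∀ {x y : ℝ}, 0 < x → x ≤ y → y ^ (-δ) ≤ x ^ (-δ) := fun hx hxy =>
    Real.rpow_le_rpow_of_nonpos hx hxy (by linarith)
  set J := (Finset.range (m' + 1)).filter (· ≤ m) with hJ
  have hterm : ∀ j ∈ J, repMean s k j * repMean s (s - k) (m - j) * repMean s (s - k) (m' - j) ≤
      K * ((B : ℝ) + 1) ^ (-δ) *
        (coeff j (memSeries s ^ k) * coeff (m' - j) (memSeries s ^ (s - k)))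
      + if m < j + B then K ^ 3 * (((m : ℝ) + 1) / 2) ^ (-δ) else 0 := by
    intro j hj
    have hjm : j ≤ m := (Finset.mem_filter.1 hj).2
    have n1 := repMean_nonneg (s := s) k j
    have n2 := repMean_nonneg (s := s) (s - k) (m - j)
    have n3 := repMean_nonneg (s := s) (s - k) (m' - j)
    have c1 := coeff_memSeries_pow_nonneg (s := s) k j
    have c3 := coeff_memSeries_pow_nonneg (s := s) (s - k) (m' - j)
    have hA : 0 ≤ K * ((B : ℝ) + 1) ^ (-δ) *
        (coeff j (memSeries s ^ k) * coeff (m' - j) (memSeries s ^ (s - k))) := by positivity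
    by_cases h : m < j + B
    · rw [if_pos h]
      have h1 : repMean s k j ≤ K * (((m : ℝ) + 1) / 2) ^ (-δ) := by
        refine ((repMean_le_coeff _ _).trans (hK _ hks j)).trans
          (mul_le_mul_of_nonneg_left (hrp (by positivity) ?_) hK0)
        have : (m : ℝ) + 1 ≤ 2 * (j + 1) := by exact_mod_cast (by omega : m + 1 ≤ 2 * (j + 1))
        linarith
      calc _ ≤ K * (((m : ℝ) + 1) / 2) ^ (-δ) * K * K :=
            mul_le_mul (mul_le_mul h1 (hleK _) n2 (by positivity)) (hleK _) n3 (by positivity)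
        _ = K ^ 3 * (((m : ℝ) + 1) / 2) ^ (-δ) := by ring
        _ ≤ _ := by linarith
    · rw [if_neg h, add_zero]
      have h1 : repMean s (s - k) (m - j) ≤ K * ((B : ℝ) + 1) ^ (-δ) := by
        refine (hle _).trans (mul_le_mul_of_nonneg_left (hrp (by positivity) ?_) hK0)
        have : (B : ℝ) ≤ (m - j : ℕ) := by exact_mod_cast (by omega : B ≤ m - j)
        linarith
      calc _ = repMean s (s - k) (m - j) * (repMean s k j * repMean s (s - k) (m' - j)) := by ring
        _ ≤ _ := mul_le_mul h1 (mul_le_mul (repMean_le_coeff _ _) (repMean_le_coeff _ _) n3 c1)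
            (by positivity) (by positivity)
  refine (Finset.sum_le_sum hterm).trans ?_
  rw [Finset.sum_add_distrib, ← Finset.mul_sum]
  refine add_le_add ?_ ?_
  · have h1 : ∑ j ∈ J, coeff j (memSeries s ^ k) * coeff (m' - j) (memSeries s ^ (s - k)) ≤ K := by
      refine le_trans (Finset.sum_le_sum_of_subset_of_nonneg (Finset.filter_subset _ _)
        fun j _ _ => mul_nonneg (coeff_memSeries_pow_nonneg _ _)
          (coeff_memSeries_pow_nonneg _ _)) ?_
      rw [← Finset.Nat.sum_antidiagonal_eq_sum_range_succ (fun i j =>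
        coeff i (memSeries s ^ k) * coeff j (memSeries s ^ (s - k))), ← coeff_mul, ← pow_add,
        Nat.add_sub_cancel' hks.le]
      exact hKs m'
    calc _ ≤ K * ((B : ℝ) + 1) ^ (-δ) * K := mul_le_mul_of_nonneg_left h1 (by positivity)
      _ = _ := by ring
  · rw [← Finset.sum_filter, Finset.sum_const, nsmul_eq_mul]
    refine mul_le_mul_of_nonneg_right ?_ (by positivity)
    have : (J.filter fun j => m < j + B) ⊆ Finset.Ioc (m - B) m := by
      intro j hj
      simp only [hJ, Finset.mem_filter, Finset.mem_range] at hj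
      rw [Finset.mem_Ioc]
      omega
    have hc := Finset.card_le_card this
    rw [Nat.card_Ioc] at hc
    exact_mod_cast hc.trans (by omega)

lemma sum_overlappingPairs_le (hs : 2 ≤ s) : ∃ K : ℝ, 0 < K ∧ ∀ (X B : ℕ) (T : Finset ℕ),
    2 * B ≤ X → (∀ m ∈ T, X ≤ m) →
    ∑ q ∈ overlappingPairs (distinctFamily s T), ∏ i ∈ q.1 ∪ q.2, memProb s i ≤
      K * (T.card : ℝ) ^ 2 * (((B : ℝ) + 1) ^ (-(1 / (s : ℝ))) +
        B * (((X : ℝ) + 1) / 2) ^ (-(1 / (s : ℝ)))) := by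
  obtain ⟨K, hK1, hK, hKs⟩ := exists_coeff_memSeries_pow_le hs
  have hs0 : (0 : ℝ) < s := by exact_mod_cast (by omega : 0 < s)
  have hδ := one_div_pos_of_two_le hs
  refine ⟨s * K ^ 3, by positivity, fun X B T hB hT => ?_⟩
  set E := ((B : ℝ) + 1) ^ (-(1 / (s : ℝ))) + B * (((X : ℝ) + 1) / 2) ^ (-(1 / (s : ℝ))) with hE
  have hmaps : ∀ q ∈ overlappingPairs (distinctFamily s T),
      ((q.1 ∩ q.2).card, ∑ i ∈ q.1, i, ∑ i ∈ q.2, i) ∈ Finset.Ico 1 s ×ˢ T ×ˢ T := by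
    intro q hq
    rw [overlappingPairs, Finset.mem_filter, Finset.mem_product, mem_distinctFamily,
      mem_distinctFamily] at hq
    obtain ⟨⟨⟨h1, h2⟩, h3, h4⟩, h5, h6⟩ := hq
    simp only [Finset.mem_product, Finset.mem_Ico]
    refine ⟨⟨?_, ?_⟩, h2, h4⟩
    · exact Finset.card_pos.2 (Finset.nonempty_iff_ne_empty.2
        fun h => h6 (Finset.disjoint_iff_inter_eq_empty.2 h))
    · refine lt_of_le_of_ne
        ((Finset.card_le_card Finset.inter_subset_left).trans h1.le) fun h => h5 ?_
      have e1 := Finset.eq_of_subset_of_card_le (Finset.inter_subset_left (s₁ := q.1) (s₂ := q.2))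
        (by omega)
      have e2 := Finset.eq_of_subset_of_card_le (Finset.inter_subset_right (s₁ := q.1) (s₂ := q.2))
        (by omega)
      exact e1.symm.trans e2
  rw [← Finset.sum_fiberwise_of_maps_to hmaps]
  have hfib : ∀ y ∈ Finset.Ico 1 s ×ˢ T ×ˢ T,
      ∑ q ∈ (overlappingPairs (distinctFamily s T)).filter
        (fun q => ((q.1 ∩ q.2).card, ∑ i ∈ q.1, i, ∑ i ∈ q.2, i) = y),
        ∏ i ∈ q.1 ∪ q.2, memProb s i ≤ K ^ 3 * E := by
    rintro ⟨k, m, m'⟩ hy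
    simp only [Finset.mem_product, Finset.mem_Ico] at hy
    obtain ⟨⟨hk1, hks⟩, hm, hm'⟩ := hy
    rw [← Finset.sum_fiberwise_of_maps_to (t := (Finset.range (m' + 1)).filter (· ≤ m))
      (g := fun q : Finset ℕ × Finset ℕ => ∑ i ∈ q.1 ∩ q.2, i)]
    · calc _ ≤ ∑ j ∈ (Finset.range (m' + 1)).filter (· ≤ m),
            repMean s k j * repMean s (s - k) (m - j) * repMean s (s - k) (m' - j) := by
            refine Finset.sum_le_sum fun j _ => sum_overlap_fiber_le _ fun q hq => ?_
            simp only [overlappingPairs, Finset.mem_filter, Finset.mem_product, mem_distinctFamily,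
              Prod.mk.injEq] at hq
            obtain ⟨⟨⟨⟨⟨h1, -⟩, h2, -⟩, -⟩, h3, h4, h5⟩, h6⟩ := hq
            exact ⟨⟨h1, h4⟩, ⟨h2, h5⟩, h3, h6⟩
        _ ≤ _ := sum_triple_le hs hK1 hK hKs hk1 hks m m' B (hB.trans (hT m hm))
        _ ≤ K ^ 3 * ((B : ℝ) + 1) ^ (-(1 / (s : ℝ))) +
            B * (K ^ 3 * (((X : ℝ) + 1) / 2) ^ (-(1 / (s : ℝ)))) := by
            refine add_le_add (mul_le_mul_of_nonneg_right (pow_le_pow_right₀ hK1 (by norm_num))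
              (by positivity)) (mul_le_mul_of_nonneg_left (mul_le_mul_of_nonneg_left ?_
              (by positivity)) (by positivity))
            refine Real.rpow_le_rpow_of_nonpos (by positivity) ?_ (by linarith)
            have : (X : ℝ) ≤ m := by exact_mod_cast hT m hm
            linarith
        _ = K ^ 3 * E := by rw [hE]; ring
    · intro q hq
      simp only [Finset.mem_filter, Prod.mk.injEq] at hq
      obtain ⟨-, -, h1, h2⟩ := hq
      rw [Finset.mem_filter, Finset.mem_range, Nat.lt_succ_iff, ← h1, ← h2]
      exact ⟨Finset.sum_le_sum_of_subset Finset.inter_subset_right,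
        Finset.sum_le_sum_of_subset Finset.inter_subset_left⟩
  refine (Finset.sum_le_sum hfib).trans ?_
  rw [Finset.sum_const, nsmul_eq_mul, Finset.card_product, Finset.card_product, Nat.card_Ico]
  have hE0 : 0 ≤ K ^ 3 * E := by positivity
  have hc : (((s - 1) * (T.card * T.card) : ℕ) : ℝ) ≤ s * (T.card : ℝ) ^ 2 := by
    rw [sq]
    exact_mod_cast Nat.mul_le_mul_right _ (Nat.sub_le s 1)
  calc _ ≤ s * (T.card : ℝ) ^ 2 * (K ^ 3 * E) := mul_le_mul_of_nonneg_right hc hE0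
    _ = _ := by ring

end Avoid

/-! ### The probability of avoiding all representations -/

section Sandwich

open PowerSeries

variable {s : ℕ}

lemma sum_biUnion_le_sum {ι κ : Type*} [DecidableEq ι] [DecidableEq κ] {f : κ → ℝ}
    (hf : ∀ x, 0 ≤ f x) (T : Finset ι) (g : ι → Finset κ) :
    ∑ x ∈ T.biUnion g, f x ≤ ∑ i ∈ T, ∑ x ∈ g i, f x := by
  induction T using Finset.induction_on with
  | empty => simp
  | insert a T ha ih =>
    rw [Finset.biUnion_insert, Finset.sum_insert ha]
    have h1 := Finset.sum_union_inter (s₁ := g a) (s₂ := T.biUnion g) (f := f)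
    have h2 : 0 ≤ ∑ x ∈ g a ∩ T.biUnion g, f x := Finset.sum_nonneg fun x _ => hf x
    linarith

lemma exists_memProb_le_rpow (hs : 2 ≤ s) : ∃ K : ℝ, 1 ≤ K ∧
    ∀ n : ℕ, memProb s n ≤ K * ((n : ℝ) + 1) ^ (-(1 / (s : ℝ))) := by
  obtain ⟨K, hK1, hK, -⟩ := exists_coeff_memSeries_pow_le hs
  refine ⟨K, hK1, fun n => ?_⟩
  have := hK 1 (by omega) n
  rwa [pow_one, memSeries, coeff_mk] at this

/-- The supports of representations of elements of `T` with repeated summands contribute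
negligibly. -/
lemma exists_sum_supportFamily_le (hs : 2 ≤ s) : ∃ K : ℝ, 0 < K ∧ ∀ (X : ℕ) (T : Finset ℕ),
    (∀ m ∈ T, X ≤ m) → ∑ S ∈ supportFamily s T, ∏ i ∈ S, memProb s i ≤
      ∑ m ∈ T, repMean s s m + K * T.card * ((X : ℝ) + 1) ^ (-(1 / (s : ℝ))) := by
  obtain ⟨K, hK0, hK⟩ := exists_sum_not_injective_le hs
  refine ⟨K, hK0, fun X T hT => ?_⟩
  set D := T.biUnion fun m => (((Finset.univ : Finset (Fin s)).piAntidiag m).filter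
    fun t => ¬ Function.Injective t).image fun t => Finset.univ.image t with hD
  have hp : ∀ S : Finset ℕ, 0 ≤ ∏ i ∈ S, memProb s i :=
    fun S => Finset.prod_nonneg fun i _ => memProb_nonneg i
  have hsub : supportFamily s T ⊆ distinctFamily s T ∪ D := by
    intro S hS
    rw [mem_supportFamily] at hS
    obtain ⟨t, ht, rfl⟩ := hS
    rw [Finset.mem_union]
    by_cases hinj : Function.Injective t
    · left
      rw [mem_distinctFamily, Finset.card_image_of_injective _ hinj, Finset.sum_image hinj.injOn]
      exact ⟨by simp, ht⟩
    · right
      refine Finset.mem_biUnion.2 ⟨_, ht, Finset.mem_image.2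
        ⟨t, Finset.mem_filter.2 ⟨?_, hinj⟩, rfl⟩⟩
      exact Finset.mem_piAntidiag.2 ⟨rfl, fun _ _ => Finset.mem_univ _⟩
  have hDsum : ∑ S ∈ D, ∏ i ∈ S, memProb s i ≤
      K * T.card * ((X : ℝ) + 1) ^ (-(1 / (s : ℝ))) := by
    calc _ ≤ ∑ m ∈ T, ∑ S ∈ (((Finset.univ : Finset (Fin s)).piAntidiag m).filter
            fun t => ¬ Function.Injective t).image fun t => Finset.univ.image t,
            ∏ i ∈ S, memProb s i :=
          sum_biUnion_le_sum hp _ _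
      _ ≤ ∑ m ∈ T, K * ((X : ℝ) + 1) ^ (-(1 / (s : ℝ))) := by
          refine Finset.sum_le_sum fun m hm => ?_
          refine (Finset.sum_image_le_of_nonneg fun S _ => hp S).trans ((hK m).trans
            (mul_le_mul_of_nonneg_left ?_ hK0.le))
          refine Real.rpow_le_rpow_of_nonpos (by positivity) ?_
            (by have := one_div_pos_of_two_le hs; linarith)
          have : (X : ℝ) ≤ m := by exact_mod_cast hT m hm
          linarith
      _ = _ := by rw [Finset.sum_const, nsmul_eq_mul]; ring
  have h1 : ∑ S ∈ supportFamily s T, ∏ i ∈ S, memProb s i ≤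
      ∑ S ∈ distinctFamily s T ∪ D, ∏ i ∈ S, memProb s i :=
    Finset.sum_le_sum_of_subset_of_nonneg hsub fun S _ _ => hp S
  have h2 := Finset.sum_union_inter (s₁ := distinctFamily s T) (s₂ := D)
    (f := fun S => ∏ i ∈ S, memProb s i)
  have h3 : 0 ≤ ∑ S ∈ distinctFamily s T ∩ D, ∏ i ∈ S, memProb s i :=
    Finset.sum_nonneg fun S _ => hp S
  rw [sum_distinctFamily] at h2
  linarith

lemma exp_neg_le_one_sub {x : ℝ} (h1 : x ≤ 1 / 2) :
    Real.exp (-(x + 2 * x ^ 2)) ≤ 1 - x := by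
  have hx : 0 < 1 - x := by linarith
  have h2 := Real.one_sub_inv_le_log_of_pos hx
  rw [← Real.le_log_iff_exp_le hx]
  refine le_trans ?_ h2
  have h3 : (1 - x)⁻¹ ≤ 1 + x + 2 * x ^ 2 := by
    rw [inv_le_iff_one_le_mul₀ hx]
    nlinarith [mul_nonneg (sq_nonneg x) (by linarith : 0 ≤ 1 - 2 * x)]
  linarith

/-- Some summand of a representation of an integer `≥ X` is at least `X / s`, and is therefore
unlikely to belong to the random set. -/
lemma prod_supportFamily_le (hs : 2 ≤ s) {K : ℝ} (hK1 : 1 ≤ K)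
    (hK : ∀ n : ℕ, memProb s n ≤ K * ((n : ℝ) + 1) ^ (-(1 / (s : ℝ)))) {X : ℕ} (hX : 1 ≤ X)
    {T : Finset ℕ} (hT : ∀ m ∈ T, X ≤ m) {S : Finset ℕ} (hS : S ∈ supportFamily s T) :
    ∏ i ∈ S, memProb s i ≤ K * s * (X : ℝ) ^ (-(1 / (s : ℝ))) ∧
      ∏ i ∈ S, memProb s i ≤ 1 / 2 := by
  have hδ := one_div_pos_of_two_le hs
  have hs0 : (0 : ℝ) < s := by exact_mod_cast (by omega : 0 < s)
  have hX0 : (0 : ℝ) < X := by exact_mod_cast hX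
  rw [mem_supportFamily] at hS
  obtain ⟨t, ht, rfl⟩ := hS
  have hle : ∀ j, ∏ i ∈ Finset.univ.image t, memProb s i ≤ memProb s (t j) := by
    intro j
    rw [← Finset.mul_prod_erase _ _ (Finset.mem_image_of_mem t (Finset.mem_univ j))]
    exact mul_le_of_le_one_right (memProb_nonneg _)
      (Finset.prod_le_one (fun i _ => memProb_nonneg i) fun i _ => memProb_le_one hs i)
  obtain ⟨j, hj⟩ : ∃ j, X ≤ s * t j := by
    by_contra! h
    have h1 := hT _ ht
    have : NeZero s := ⟨by omega⟩
    have h2 : ∑ j, s * t j < ∑ _j : Fin s, X :=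
      Finset.sum_lt_sum_of_nonempty Finset.univ_nonempty fun j _ => h j
    rw [← Finset.mul_sum, Finset.sum_const, Finset.card_univ, Fintype.card_fin, smul_eq_mul] at h2
    exact absurd h1 (not_le.2 (lt_of_mul_lt_mul_left h2 (Nat.zero_le s)))
  refine ⟨(hle j).trans ((hK _).trans ?_), (hle j).trans (memProb_le_half hs _)⟩
  rw [mul_assoc]
  refine mul_le_mul_of_nonneg_left ?_ (by linarith)
  have hj' : (X : ℝ) / s ≤ (t j : ℝ) + 1 := by
    rw [div_le_iff₀ hs0]
    have : (X : ℝ) ≤ s * t j := by exact_mod_cast hj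
    nlinarith
  calc ((t j : ℝ) + 1) ^ (-(1 / (s : ℝ))) ≤ ((X : ℝ) / s) ^ (-(1 / (s : ℝ))) :=
        Real.rpow_le_rpow_of_nonpos (by positivity) hj' (by linarith)
    _ = (s : ℝ) ^ (1 / (s : ℝ)) * (X : ℝ) ^ (-(1 / (s : ℝ))) := by
        rw [Real.div_rpow hX0.le hs0.le, Real.rpow_neg hs0.le, div_inv_eq_mul, mul_comm]
    _ ≤ s * (X : ℝ) ^ (-(1 / (s : ℝ))) := by
        refine mul_le_mul_of_nonneg_right ?_ (by positivity)
        calc (s : ℝ) ^ (1 / (s : ℝ)) ≤ (s : ℝ) ^ (1 : ℝ) :=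
              Real.rpow_le_rpow_of_exponent_le (by exact_mod_cast (by omega : 1 ≤ s))
                ((one_div_le_half hs).trans (by norm_num))
          _ = s := Real.rpow_one _

lemma exists_repMean_le (hs : 2 ≤ s) : ∃ K : ℝ, 1 ≤ K ∧ ∀ m, repMean s s m ≤ K := by
  obtain ⟨K, hK1, -, hKs⟩ := exists_coeff_memSeries_pow_le hs
  exact ⟨K, hK1, fun m => (repMean_le_coeff _ _).trans (hKs m)⟩

/-- The lower bound: all supports have probability `O(X ^ (-1/s))`, so that the product of the
`1 - p(S)` is close to the exponential of minus their sum. -/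
lemma exists_le_avoidProb (hs : 2 ≤ s) : ∃ D : ℝ, 0 < D ∧ ∀ (X : ℕ) (T V : Finset ℕ),
    1 ≤ X → (∀ m ∈ T, X ≤ m) → (∀ S ∈ supportFamily s T, S ⊆ V) →
    Real.exp (-(∑ m ∈ T, repMean s s m + D * T.card * (X : ℝ) ^ (-(1 / (s : ℝ))))) ≤
      avoidProb (memProb s) V (supportFamily s T) := by
  obtain ⟨K, hK1, hK⟩ := exists_memProb_le_rpow hs
  obtain ⟨L, hL0, hL⟩ := exists_sum_supportFamily_le hs
  obtain ⟨M, hM1, hM⟩ := exists_repMean_le hs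
  have hδ := one_div_pos_of_two_le hs
  have hs0 : (0 : ℝ) < s := by exact_mod_cast (by omega : 0 < s)
  refine ⟨L + 2 * (K * s) * (M + L), by positivity, fun X T V hX hT hV => ?_⟩
  have hX1 : (1 : ℝ) ≤ X := by exact_mod_cast hX
  refine le_trans ?_ (prod_one_sub_le_avoidProb memProb_nonneg (memProb_le_one hs) _ hV)
  set E := (X : ℝ) ^ (-(1 / (s : ℝ))) with hE
  have hE0 : 0 < E := by positivity
  have hE1 : E ≤ 1 := Real.rpow_le_one_of_one_le_of_nonpos hX1 (by linarith)
  set μ := ∑ m ∈ T, repMean s s m with hμ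
  have hμM : μ ≤ T.card * M := by
    rw [← nsmul_eq_mul, ← Finset.sum_const]
    exact Finset.sum_le_sum fun m _ => hM m
  have hsum : ∑ S ∈ supportFamily s T, ∏ i ∈ S, memProb s i ≤ μ + L * T.card * E := by
    refine (hL X T hT).trans (add_le_add le_rfl (mul_le_mul_of_nonneg_left ?_ (by positivity)))
    exact Real.rpow_le_rpow_of_nonpos (by positivity) (by linarith) (by linarith)
  calc _ ≤ Real.exp (∑ S ∈ supportFamily s T,
        -((∏ i ∈ S, memProb s i) + 2 * (∏ i ∈ S, memProb s i) ^ 2)) := by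
        refine Real.exp_le_exp.2 ?_
        rw [Finset.sum_neg_distrib]
        refine neg_le_neg ?_
        calc _ ≤ ∑ S ∈ supportFamily s T, (1 + 2 * (K * s * E)) * ∏ i ∈ S, memProb s i := by
              refine Finset.sum_le_sum fun S hS => ?_
              have h1 := (prod_supportFamily_le hs hK1 hK hX hT hS).1
              have h2 : 0 ≤ ∏ i ∈ S, memProb s i := Finset.prod_nonneg fun i _ => memProb_nonneg i
              nlinarith [mul_le_mul_of_nonneg_right h1 h2]
          _ ≤ (1 + 2 * (K * s * E)) * (μ + L * T.card * E) := by
              rw [← Finset.mul_sum]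
              exact mul_le_mul_of_nonneg_left hsum (by positivity)
          _ ≤ _ := by
              have h3 : μ + L * T.card * E ≤ T.card * (M + L) := by
                have : L * T.card * E ≤ L * T.card * 1 :=
                  mul_le_mul_of_nonneg_left hE1 (by positivity)
                linarith
              have h4 := mul_le_mul_of_nonneg_left h3 (by positivity : 0 ≤ 2 * (K * s * E))
              linarith
    _ = ∏ S ∈ supportFamily s T,
        Real.exp (-((∏ i ∈ S, memProb s i) + 2 * (∏ i ∈ S, memProb s i) ^ 2)) :=
        Real.exp_sum _ _
    _ ≤ _ := Finset.prod_le_prod (fun S _ => (Real.exp_pos _).le) fun S hS =>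
        exp_neg_le_one_sub
          (prod_supportFamily_le hs hK1 hK hX hT hS).2

/-- The upper bound: Janson's inequality for the representations with distinct summands. -/
lemma exists_avoidProb_le (hs : 2 ≤ s) : ∃ D : ℝ, 0 < D ∧ ∀ (X : ℕ) (T V : Finset ℕ),
    4 ≤ X → (∀ m ∈ T, X ≤ m) → (∀ S ∈ supportFamily s T, S ⊆ V) →
    avoidProb (memProb s) V (supportFamily s T) ≤
    Real.exp (-(∑ m ∈ T, repMean s s m) +
      D * (T.card : ℝ) ^ 2 * (X : ℝ) ^ (-((1 / (s : ℝ)) ^ 2 / 2))) := by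
  obtain ⟨K, hK0, hK⟩ := sum_overlappingPairs_le hs
  have hδ := one_div_pos_of_two_le hs
  have hδ2 := one_div_le_half hs
  set δ := 1 / (s : ℝ) with hδdef
  refine ⟨K * 3, by positivity, fun X T V hX hT hV => ?_⟩
  have hX4 : (4 : ℝ) ≤ X := by exact_mod_cast hX
  have hX0 : (0 : ℝ) < X := by linarith
  refine (avoidProb_anti memProb_nonneg (memProb_le_one hs)
    (distinctFamily_subset_supportFamily T)).trans ?_
  refine (avoidProb_le_exp memProb_nonneg (memProb_le_one hs) _
    fun S hS => hV S (distinctFamily_subset_supportFamily T hS)).trans ?_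
  rw [sum_distinctFamily]
  -- The cut-off `B = ⌊X ^ (δ / 2)⌋` balances the two error terms.
  set B := ⌊(X : ℝ) ^ (δ / 2)⌋₊ with hB
  have hBle : (B : ℝ) ≤ (X : ℝ) ^ (δ / 2) := Nat.floor_le (by positivity)
  have hBX : 2 * B ≤ X := by
    have h1 : (X : ℝ) ^ (δ / 2) ≤ (X : ℝ) ^ (1 / 2 : ℝ) :=
      Real.rpow_le_rpow_of_exponent_le (by linarith) (by linarith)
    rw [← Real.sqrt_eq_rpow] at h1
    have h2 : Real.sqrt X ≤ X / 2 := by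
      rw [Real.sqrt_le_left (by positivity)]
      nlinarith
    exact_mod_cast (by linarith : 2 * (B : ℝ) ≤ X)
  refine Real.exp_le_exp.2 (add_le_add le_rfl ((hK X B T hBX hT).trans ?_))
  have h1 : ((B : ℝ) + 1) ^ (-δ) ≤ (X : ℝ) ^ (-(δ ^ 2 / 2)) := by
    calc ((B : ℝ) + 1) ^ (-δ) ≤ ((X : ℝ) ^ (δ / 2)) ^ (-δ) :=
          Real.rpow_le_rpow_of_nonpos (by positivity) (Nat.lt_floor_add_one _).le (by linarith)
      _ = _ := by rw [← Real.rpow_mul hX0.le]; ring_nf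
  have h2 : B * (((X : ℝ) + 1) / 2) ^ (-δ) ≤ 2 * (X : ℝ) ^ (-(δ ^ 2 / 2)) := by
    calc B * (((X : ℝ) + 1) / 2) ^ (-δ) ≤ (X : ℝ) ^ (δ / 2) * ((X : ℝ) / 2) ^ (-δ) :=
          mul_le_mul hBle (Real.rpow_le_rpow_of_nonpos (by positivity) (by linarith) (by linarith))
            (by positivity) (by positivity)
      _ = (2 : ℝ) ^ δ * (X : ℝ) ^ (-(δ / 2)) := by
          rw [Real.div_rpow hX0.le (by norm_num), Real.rpow_neg (by norm_num : (0 : ℝ) ≤ 2),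
            div_inv_eq_mul, ← mul_assoc, ← Real.rpow_add hX0, mul_comm]
          ring_nf
      _ ≤ 2 * (X : ℝ) ^ (-(δ ^ 2 / 2)) := by
          refine mul_le_mul ?_ (Real.rpow_le_rpow_of_exponent_le (by linarith) (by nlinarith))
            (by positivity) (by norm_num)
          calc (2 : ℝ) ^ δ ≤ (2 : ℝ) ^ (1 : ℝ) :=
                Real.rpow_le_rpow_of_exponent_le (by norm_num) (by linarith)
            _ = 2 := Real.rpow_one _
  calc _ ≤ K * (T.card : ℝ) ^ 2 *
        ((X : ℝ) ^ (-(δ ^ 2 / 2)) + 2 * (X : ℝ) ^ (-(δ ^ 2 / 2))) :=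
        mul_le_mul_of_nonneg_left (add_le_add h1 h2) (by positivity)
    _ = _ := by ring

/-- Uniformly in sets `T ⊆ [X, ∞)` of at most `C log X` elements, the number of representations of
elements of `T` behaves like a Poisson variable as far as its vanishing is concerned. -/
lemma eventually_avoidProb_bounds (hs : 2 ≤ s) (C ε : ℝ) (hε : 0 < ε) :
    ∀ᶠ X : ℕ in atTop, ∀ T V : Finset ℕ, (∀ m ∈ T, X ≤ m) → (T.card : ℝ) ≤ C * Real.log X →
      (∀ S ∈ supportFamily s T, S ⊆ V) →
      Real.exp (-(∑ m ∈ T, repMean s s m) - ε) ≤ avoidProb (memProb s) V (supportFamily s T) ∧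
      avoidProb (memProb s) V (supportFamily s T) ≤ Real.exp (-(∑ m ∈ T, repMean s s m) + ε) := by
  obtain ⟨D, hD0, hD⟩ := exists_le_avoidProb hs
  obtain ⟨D', hD'0, hD'⟩ := exists_avoidProb_le hs
  have hδ := one_div_pos_of_two_le hs
  set δ := 1 / (s : ℝ) with hδdef
  have hlim : ∀ (k : ℕ) (a c : ℝ), 0 < a →
      Tendsto (fun X : ℕ => c * (Real.log X ^ k * (X : ℝ) ^ (-a))) atTop (nhds 0) := by
    intro k a c ha
    have h1 := (isLittleO_log_rpow_rpow_atTop (k : ℝ) ha).tendsto_div_nhds_zero.comp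
      tendsto_natCast_atTop_atTop
    have h2 := h1.const_mul c
    rw [mul_zero] at h2
    refine h2.congr fun X => ?_
    simp only [Function.comp]
    rw [Real.rpow_natCast, Real.rpow_neg (by positivity), div_eq_mul_inv]
  have e1 := (hlim 1 δ (D * C) hδ).eventually_lt_const hε
  have e2 := (hlim 2 (δ ^ 2 / 2) (D' * C ^ 2) (by positivity)).eventually_lt_const hε
  filter_upwards [e1, e2, eventually_ge_atTop 4] with X h1 h2 hX T V hT hcard hV
  have hX0 : (0 : ℝ) < X := by exact_mod_cast (by omega : 0 < X)
  constructor
  · refine le_trans (Real.exp_le_exp.2 ?_) (hD X T V (by omega) hT hV)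
    have : D * T.card * (X : ℝ) ^ (-δ) ≤ D * C * (Real.log X ^ 1 * (X : ℝ) ^ (-δ)) := by
      calc _ ≤ D * (C * Real.log X) * (X : ℝ) ^ (-δ) :=
            mul_le_mul_of_nonneg_right (mul_le_mul_of_nonneg_left hcard hD0.le) (by positivity)
        _ = _ := by ring
    linarith
  · refine (hD' X T V hX hT hV).trans (Real.exp_le_exp.2 ?_)
    have : D' * (T.card : ℝ) ^ 2 * (X : ℝ) ^ (-(δ ^ 2 / 2)) ≤
        D' * C ^ 2 * (Real.log X ^ 2 * (X : ℝ) ^ (-(δ ^ 2 / 2))) := by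
      calc _ ≤ D' * (C * Real.log X) ^ 2 * (X : ℝ) ^ (-(δ ^ 2 / 2)) :=
            mul_le_mul_of_nonneg_right (mul_le_mul_of_nonneg_left
              (pow_le_pow_left₀ (by positivity) hcard 2) hD'0.le) (by positivity)
        _ = _ := by ring
    linarith

end Sandwich

/-! ### The event that the sumset misses a finite set -/

section Miss

variable {U : Type*} {s : ℕ} {A : U → Set ℕ}

/-- The event that the sumset `sA` contains no element of `T`. -/
def missEvent (s : ℕ) (A : U → Set ℕ) (T : Finset ℕ) : Set U :=
  {u | ∀ m ∈ T, m ∉ foldSumset s (A u)}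

lemma mem_missEvent_iff {T : Finset ℕ} {u : U} :
    u ∈ missEvent s A T ↔ ∀ S ∈ supportFamily s T, ¬ (S : Set ℕ) ⊆ A u := by
  constructor
  · intro h S hS hSA
    obtain ⟨t, ht, rfl⟩ := mem_supportFamily.1 hS
    exact h _ ht ⟨t, fun i => hSA (by simp), rfl⟩
  · rintro h m hm ⟨t, ht, rfl⟩
    refine h _ (mem_supportFamily.2 ⟨t, hm, rfl⟩) fun a ha => ?_
    rw [Finset.mem_coe, Finset.mem_image] at ha
    obtain ⟨j, -, rfl⟩ := ha
    exact ht j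

lemma missEvent_union (T T' : Finset ℕ) :
    missEvent s A (T ∪ T') = missEvent s A T ∩ missEvent s A T' := by
  ext u
  simp only [missEvent, Set.mem_ofPred_eq, Set.mem_inter_iff, Finset.mem_union, or_imp,
    forall_and]

end Miss

/-! ### Short gaps almost surely, and the second moment method -/

section Random

variable {U : Type*} [MeasurableSpace U] {P : Measure U} {s : ℕ} {A : U → Set ℕ}

lemma measureReal_mem (hs : 2 ≤ s) (hA : IsPseudoPowerSequence P s A) (n : ℕ) :
    P.real {u | n ∈ A u} = memProb s n := by
  rcases Nat.eq_zero_or_pos n with rfl | hn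
  · have : {u | 0 ∈ A u} = ∅ := Set.eq_empty_of_forall_notMem fun u hu =>
      absurd (hA.pos u 0 hu) (by norm_num)
    rw [this, measureReal_empty, memProb_zero hs]
  · exact hA.prob_mem n hn

lemma measureReal_cylinder [IsProbabilityMeasure P] (hs : 2 ≤ s)
    (hA : IsPseudoPowerSequence P s A) {V R : Finset ℕ} (hR : R ⊆ V) :
    P.real {u | ∀ n ∈ V, n ∈ A u ↔ n ∈ R} =
      (∏ i ∈ R, memProb s i) * ∏ i ∈ V \ R, (1 - memProb s i) := by
  set E : ℕ → Set U := fun n => {u | n ∈ A u} with hE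
  set F : ℕ → Set U := fun n => if n ∈ R then E n else (E n)ᶜ with hF
  have hset : {u | ∀ n ∈ V, n ∈ A u ↔ n ∈ R} = ⋂ n ∈ V, F n := by
    ext u
    simp only [Set.mem_ofPred_eq, Set.mem_iInter]
    refine forall₂_congr fun n _ => ?_
    by_cases h : n ∈ R <;> simp [hF, hE, h]
  have hgen : ∀ n, MeasurableSet[MeasurableSpace.generateFrom {E n}] (E n) := fun n =>
    MeasurableSpace.measurableSet_generateFrom (Set.mem_singleton _)
  have hmeas : P (⋂ n ∈ V, F n) = ∏ n ∈ V, P (F n) := by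
    refine iIndep.meas_biInter (m := fun n => MeasurableSpace.generateFrom {E n})
      ((iIndepSet_iff_iIndep _ _).1 hA.indep) fun n _ => ?_
    by_cases h : n ∈ R
    · simp only [hF, h, if_true]; exact hgen n
    · simp only [hF, h, if_false]
      exact @MeasurableSet.compl _ _ (MeasurableSpace.generateFrom {E n}) (hgen n)
  rw [hset, Measure.real, hmeas, ENNReal.toReal_prod, ← Finset.prod_sdiff hR, mul_comm]
  congr 1
  · refine Finset.prod_congr rfl fun n hn => ?_
    simp only [hF, hn, if_true]
    exact measureReal_mem hs hA n
  · refine Finset.prod_congr rfl fun n hn => ?_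
    simp only [hF, (Finset.mem_sdiff.1 hn).2, if_false]
    rw [← measureReal_mem hs hA n]
    exact probReal_compl_eq_one_sub (hA.measurableSet_mem n)

lemma measurableSet_missEvent (hA : IsPseudoPowerSequence P s A) (T : Finset ℕ) :
    MeasurableSet (missEvent s A T) := by
  have : missEvent s A T = ⋂ S ∈ supportFamily s T, (⋂ n ∈ S, {u | n ∈ A u})ᶜ := by
    ext u
    rw [mem_missEvent_iff]
    simp [Set.subset_def]
  rw [this]
  exact Finset.measurableSet_biInter _ fun S _ =>
    (Finset.measurableSet_biInter _ fun n _ => hA.measurableSet_mem n).compl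

lemma measureReal_missEvent [IsProbabilityMeasure P] (hs : 2 ≤ s)
    (hA : IsPseudoPowerSequence P s A) {T V : Finset ℕ} (hV : ∀ S ∈ supportFamily s T, S ⊆ V) :
    P.real (missEvent s A T) = avoidProb (memProb s) V (supportFamily s T) := by
  classical
  set Q := V.powerset.filter fun R => ∀ S ∈ supportFamily s T, ¬ S ⊆ R with hQ
  have hset : missEvent s A T = ⋃ R ∈ Q, {u | ∀ n ∈ V, n ∈ A u ↔ n ∈ R} := by
    ext u
    simp only [Set.mem_iUnion, mem_missEvent_iff, Set.mem_ofPred_eq, exists_prop, hQ,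
      Finset.mem_filter, Finset.mem_powerset]
    constructor
    · intro h
      refine ⟨V.filter (· ∈ A u), ⟨Finset.filter_subset _ _, fun S hS hSV => h S hS fun n hn =>
        (Finset.mem_filter.1 (hSV hn)).2⟩, fun n hn => by simp [hn]⟩
    · rintro ⟨R, ⟨-, hR⟩, hu⟩ S hS hSA
      exact hR S hS fun n hn => (hu n (hV S hS hn)).1 (hSA hn)
  rw [hset, measureReal_biUnion_finset]
  · rw [avoidProb, bernoulliMean, hQ, Finset.sum_filter]
    refine Finset.sum_congr rfl fun R hR => ?_
    rw [measureReal_cylinder hs hA (Finset.mem_powerset.1 hR), mul_ite, mul_one, mul_zero]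
  · intro R hR R' hR' hne
    refine Set.disjoint_left.2 fun u hu hu' => hne ?_
    rw [Finset.mem_coe, hQ, Finset.mem_filter, Finset.mem_powerset] at hR hR'
    ext n
    by_cases hn : n ∈ V
    · exact (hu n hn).symm.trans (hu' n hn)
    · exact ⟨fun h => absurd (hR.1 h) hn, fun h => absurd (hR'.1 h) hn⟩
  · intro R _
    have : {u | ∀ n ∈ V, n ∈ A u ↔ n ∈ R} =
        ⋂ n ∈ V, if n ∈ R then {u | n ∈ A u} else {u | n ∈ A u}ᶜ := by
      ext u
      simp only [Set.mem_ofPred_eq, Set.mem_iInter]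
      refine forall₂_congr fun n _ => ?_
      by_cases h : n ∈ R <;> simp [h]
    rw [this]
    refine Finset.measurableSet_biInter _ fun n _ => ?_
    split_ifs
    · exact hA.measurableSet_mem n
    · exact (hA.measurableSet_mem n).compl

/-- The Poisson-like estimate for the probability that `sA` misses `T`. -/
lemma eventually_measureReal_missEvent [IsProbabilityMeasure P] (hs : 2 ≤ s)
    (hA : IsPseudoPowerSequence P s A) (C ε : ℝ) (hε : 0 < ε) :
    ∀ᶠ X : ℕ in atTop, ∀ T : Finset ℕ, (∀ m ∈ T, X ≤ m) → (T.card : ℝ) ≤ C * Real.log X →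
      Real.exp (-(∑ m ∈ T, repMean s s m) - ε) ≤ P.real (missEvent s A T) ∧
      P.real (missEvent s A T) ≤ Real.exp (-(∑ m ∈ T, repMean s s m) + ε) := by
  filter_upwards [eventually_avoidProb_bounds hs C ε hε] with X hX T hT hcard
  have hV : ∀ S ∈ supportFamily s T, S ⊆ (supportFamily s T).biUnion id := fun S hS =>
    Finset.subset_biUnion_of_mem id hS
  rw [measureReal_missEvent hs hA hV]
  exact hX T _ hT hcard hV

lemma poissonParam_pos (hs : 2 ≤ s) : 0 < poissonParam s := by
  have hs0 : (0 : ℝ) < s := by exact_mod_cast (by omega : 0 < s)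
  have := Real.Gamma_pos_of_pos (one_div_pos_of_two_le hs)
  unfold poissonParam
  positivity

lemma ae_eventually_exists_mem [IsProbabilityMeasure P] (hs : 2 ≤ s)
    (hA : IsPseudoPowerSequence P s A) {c : ℝ} (hc : 1 / poissonParam s < c) :
    ∀ᵐ u ∂P, ∀ᶠ x : ℕ in atTop,
      ∃ m ∈ foldSumset s (A u), x < m ∧ (m : ℝ) - x ≤ c * Real.log x := by
  have hl := poissonParam_pos hs
  have hc0 : 0 < c := (one_div_pos.2 hl).trans hc
  -- A window of about `c log x` integers then has mean at least `l c log x`, with `l c > 1`.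
  obtain ⟨l, hl1, hl2⟩ : ∃ l, 1 / c < l ∧ l < poissonParam s :=
    exists_between ((one_div_lt hl hc0).1 hc)
  have hl0 : 0 < l := (one_div_pos.2 hc0).trans hl1
  have hlc : 1 < l * c := (div_lt_iff₀ hc0).1 hl1
  set T : ℕ → Finset ℕ := fun x => Finset.Ioc x (x + ⌊c * Real.log x⌋₊) with hT
  have hbound : ∀ᶠ x : ℕ in atTop,
      P.real (missEvent s A (T x)) ≤ Real.exp (l + 1) * (x : ℝ) ^ (-(l * c)) := by
    have h1 := (tendsto_repMean hs).eventually_const_lt hl2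
    rw [eventually_atTop] at h1
    obtain ⟨N, hN⟩ := h1
    filter_upwards [eventually_measureReal_missEvent hs hA c 1 one_pos, eventually_ge_atTop N,
      eventually_ge_atTop 1] with x hx hxN hx1
    have hx0 : (0 : ℝ) < x := by exact_mod_cast hx1
    have hlog : 0 ≤ Real.log x := Real.log_nonneg (by exact_mod_cast hx1)
    have hcard : (T x).card = ⌊c * Real.log x⌋₊ := by simp [hT]
    have hle : (⌊c * Real.log x⌋₊ : ℝ) ≤ c * Real.log x := Nat.floor_le (by positivity)
    refine (hx (T x) (fun m hm => (Finset.mem_Ioc.1 hm).1.le) (by rw [hcard]; exact hle)).2.trans ?_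
    have hμ : l * (c * Real.log x - 1) ≤ ∑ m ∈ T x, repMean s s m := by
      calc l * (c * Real.log x - 1) ≤ l * (T x).card := by
            refine mul_le_mul_of_nonneg_left ?_ hl0.le
            rw [hcard]
            exact (Nat.sub_one_lt_floor _).le
        _ = ∑ m ∈ T x, l := by rw [Finset.sum_const, nsmul_eq_mul, mul_comm]
        _ ≤ _ := Finset.sum_le_sum fun m hm =>
            (hN m (hxN.trans (Finset.mem_Ioc.1 hm).1.le)).le
    rw [Real.rpow_def_of_pos hx0, ← Real.exp_add]
    refine Real.exp_le_exp.2 ?_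
    linarith
  have hsum : Summable fun x : ℕ => P.real (missEvent s A (T x)) := by
    have h1 : Summable fun x : ℕ => Real.exp (l + 1) * (x : ℝ) ^ (-(l * c)) :=
      (Real.summable_nat_rpow.2 (by linarith)).mul_left _
    refine Summable.of_norm_bounded_eventually_nat h1 ?_
    filter_upwards [hbound] with x hx
    rwa [Real.norm_of_nonneg measureReal_nonneg]
  have hne : ∑' x, P (missEvent s A (T x)) ≠ ⊤ := by
    have h : ∀ x, P (missEvent s A (T x)) = ENNReal.ofReal (P.real (missEvent s A (T x))) :=
      fun x => (ofReal_measureReal).symm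
    rw [tsum_congr h]
    exact hsum.tsum_ofReal_ne_top
  filter_upwards [ae_eventually_notMem hne] with u hu
  filter_upwards [hu, eventually_ge_atTop 1] with x hx hx1
  simp only [missEvent, Set.mem_ofPred_eq, not_forall, not_not] at hx
  obtain ⟨m, hm, hmem⟩ := hx
  rw [hT, Finset.mem_Ioc] at hm
  refine ⟨m, hmem, hm.1, ?_⟩
  have hlog : 0 ≤ Real.log x := Real.log_nonneg (by exact_mod_cast hx1)
  have h2 : (⌊c * Real.log x⌋₊ : ℝ) ≤ c * Real.log x := Nat.floor_le (by positivity)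
  have h3 : (m : ℝ) ≤ x + ⌊c * Real.log x⌋₊ := by exact_mod_cast hm.2
  linarith

/-- Second moment method: almost pairwise independent events with large total probability do not
all fail, up to small probability. -/
lemma measureReal_iInter_compl_le [IsProbabilityMeasure P] {κ : Type*} [DecidableEq κ]
    (J : Finset κ) {E : κ → Set U} (hE : ∀ i, MeasurableSet (E i)) {η : ℝ} (hη : 0 ≤ η)
    (hS : 0 < ∑ i ∈ J, P.real (E i))
    (hpair : ∀ i ∈ J, ∀ j ∈ J, i ≠ j →
      P.real (E i ∩ E j) ≤ (1 + η) * (P.real (E i) * P.real (E j))) :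
    P.real (⋂ i ∈ J, (E i)ᶜ) ≤ η + 1 / ∑ i ∈ J, P.real (E i) := by
  set S := ∑ i ∈ J, P.real (E i) with hSdef
  set f : κ → U → ℝ := fun i => (E i).indicator fun _ => 1 with hf
  set N : U → ℝ := fun u => ∑ i ∈ J, f i u with hN
  have hfint : ∀ i, Integrable (f i) P := fun i => (integrable_const 1).indicator (hE i)
  have hffint : ∀ i j, Integrable (fun u => f i u * f j u) P := fun i j => by
    have : (fun u => f i u * f j u) = (E i ∩ E j).indicator fun _ => 1 := by
      funext u
      by_cases h1 : u ∈ E i <;> by_cases h2 : u ∈ E j <;> simp [hf, h1, h2]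
    rw [this]
    exact (integrable_const 1).indicator ((hE i).inter (hE j))
  have hNint : Integrable N P := integrable_finsetSum _ fun i _ => hfint i
  have hN2 : (fun u => N u ^ 2) = fun u => ∑ i ∈ J, ∑ j ∈ J, f i u * f j u := by
    funext u
    rw [hN, sq, Finset.sum_mul_sum]
  have hN2int : Integrable (fun u => N u ^ 2) P := by
    rw [hN2]
    exact integrable_finsetSum _ fun i _ => integrable_finsetSum _ fun j _ => hffint i j
  have hEN : ∫ u, N u ∂P = S := by
    rw [hN, integral_finsetSum _ fun i _ => hfint i]
    refine Finset.sum_congr rfl fun i _ => ?_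
    rw [hf]
    exact integral_indicator_one (hE i)
  have hEff : ∀ i j, ∫ u, f i u * f j u ∂P = P.real (E i ∩ E j) := fun i j => by
    rw [← integral_indicator_one ((hE i).inter (hE j))]
    congr 1
    funext u
    by_cases h1 : u ∈ E i <;> by_cases h2 : u ∈ E j <;> simp [hf, h1, h2]
  have hEN2 : ∫ u, N u ^ 2 ∂P ≤ S + (1 + η) * S ^ 2 := by
    rw [hN2, integral_finsetSum _ fun i _ => integrable_finsetSum _ fun j _ => hffint i j]
    have hrow : ∀ i ∈ J, ∫ u, ∑ j ∈ J, f i u * f j u ∂P ≤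
        P.real (E i) + (1 + η) * (P.real (E i) * S) := by
      intro i hi
      rw [integral_finsetSum _ fun j _ => hffint i j]
      simp only [hEff]
      rw [← Finset.add_sum_erase _ _ hi, Set.inter_self]
      refine add_le_add le_rfl ?_
      calc _ ≤ ∑ j ∈ J.erase i, (1 + η) * (P.real (E i) * P.real (E j)) :=
            Finset.sum_le_sum fun j hj => hpair i hi j (Finset.mem_of_mem_erase hj)
              (Finset.ne_of_mem_erase hj).symm
        _ ≤ ∑ j ∈ J, (1 + η) * (P.real (E i) * P.real (E j)) :=
            Finset.sum_le_sum_of_subset_of_nonneg (Finset.erase_subset _ _) fun j _ _ => by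
              have := measureReal_nonneg (μ := P) (s := E i)
              have := measureReal_nonneg (μ := P) (s := E j)
              positivity
        _ = _ := by rw [← Finset.mul_sum, ← Finset.mul_sum]
    refine (Finset.sum_le_sum hrow).trans_eq ?_
    rw [Finset.sum_add_distrib, ← Finset.mul_sum, ← Finset.sum_mul, sq]
  have hmZ : MeasurableSet (⋂ i ∈ J, (E i)ᶜ) :=
    Finset.measurableSet_biInter _ fun i _ => (hE i).compl
  -- Chebyshev's inequality: `N = 0` forces `(N - S) ^ 2 = S ^ 2`.
  have hmain : P.real (⋂ i ∈ J, (E i)ᶜ) * S ^ 2 ≤ ∫ u, (N u ^ 2 - 2 * S * N u + S ^ 2) ∂P := by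
    have h1 : P.real (⋂ i ∈ J, (E i)ᶜ) * S ^ 2 =
        ∫ u, (⋂ i ∈ J, (E i)ᶜ).indicator (fun _ => S ^ 2) u ∂P := by
      rw [integral_indicator_const _ hmZ, smul_eq_mul]
    rw [h1]
    refine integral_mono ((integrable_const _).indicator hmZ)
      ((hN2int.sub (hNint.const_mul _)).add (integrable_const _)) fun u => ?_
    by_cases hu : u ∈ ⋂ i ∈ J, (E i)ᶜ
    · have h0 : N u = 0 := by
        rw [hN]
        refine Finset.sum_eq_zero fun i hi => ?_
        have : u ∉ E i := Set.mem_iInter₂.1 hu i hi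
        simp [hf, this]
      rw [Set.indicator_of_mem hu]
      simp [h0]
    · rw [Set.indicator_of_notMem hu]
      nlinarith [sq_nonneg (N u - S)]
  have hsub : Integrable (fun u => N u ^ 2 - 2 * S * N u) P := hN2int.sub (hNint.const_mul _)
  rw [integral_add hsub (integrable_const _), integral_sub hN2int (hNint.const_mul _),
    integral_const_mul, hEN] at hmain
  simp only [integral_const, probReal_univ, smul_eq_mul, one_mul] at hmain
  have h3 : P.real (⋂ i ∈ J, (E i)ᶜ) * S ^ 2 ≤ (η + 1 / S) * S ^ 2 := by
    have : (η + 1 / S) * S ^ 2 = S + η * S ^ 2 := by field_simp; ring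
    rw [this]
    linarith
  exact le_of_mul_le_mul_right h3 (by positivity)

end Random

/-! ### Long gaps infinitely often -/

section LongGaps

variable {U : Type*} [MeasurableSpace U] {P : Measure U} {s : ℕ} {A : U → Set ℕ}

/-- The event that some interval of length at least `c log (2X)` inside `[X, 2X)` is free of
elements of `sA`. -/
def longGapEvent (s : ℕ) (A : U → Set ℕ) (c : ℝ) (X : ℕ) : Set U :=
  {u | ∃ y L : ℕ, X ≤ y ∧ y + L ≤ 2 * X ∧ c * Real.log (2 * X) ≤ L ∧
    ∀ m, y ≤ m → m < y + L → m ∉ foldSumset s (A u)}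

/-- Below the critical constant `1 / λ` the interval `[X, 2X)` contains a long gap with probability
tending to one. There are about `X / log X` disjoint windows, each empty with probability at least
`X ^ (-θ)` for some `θ < 1`, and the emptiness events are almost pairwise independent. -/
lemma eventually_measureReal_longGapEvent [IsProbabilityMeasure P] (hs : 2 ≤ s)
    (hA : IsPseudoPowerSequence P s A) {c : ℝ} (hc0 : 0 < c) (hc : c < 1 / poissonParam s)
    {η : ℝ} (hη : 0 < η) :
    ∀ᶠ X : ℕ in atTop, P.real (longGapEvent s A c X)ᶜ ≤ 2 * η := by
  have hl := poissonParam_pos hs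
  obtain ⟨c₁, hcc₁, hc₁⟩ := exists_between hc
  have hc₁0 : 0 < c₁ := hc0.trans hcc₁
  obtain ⟨l, hl1, hl2⟩ : ∃ l, poissonParam s < l ∧ l < 1 / c₁ :=
    exists_between ((lt_one_div hc₁0 hl).1 hc₁)
  have hl0 : 0 < l := hl.trans hl1
  set θ := l * c₁ with hθ
  have hθ1 : θ < 1 := (lt_div_iff₀ hc₁0).1 hl2
  -- Three factors `exp ε` are lost when comparing a pair probability with a product.
  set ε := Real.log (1 + η) / 3 with hε
  have hε0 : 0 < ε := div_pos (Real.log_pos (by linarith)) (by norm_num)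
  have hexp : Real.exp (3 * ε) = 1 + η := by
    rw [hε, mul_div_cancel₀ _ (by norm_num), Real.exp_log (by linarith)]
  have hlogt : Tendsto (fun X : ℕ => Real.log X) atTop atTop :=
    Real.tendsto_log_atTop.comp tendsto_natCast_atTop_atTop
  have e1 : ∀ᶠ X : ℕ in atTop, (c * Real.log 2 + 1) / (c₁ - c) ≤ Real.log X :=
    hlogt.eventually_ge_atTop _
  have e2 : ∀ᶠ X : ℕ in atTop, Real.log X ≤ 1 / (2 * c₁) * X := by
    have h := tendsto_natCast_atTop_atTop.eventually
      (Real.isLittleO_log_id_atTop.def (by positivity : 0 < 1 / (2 * c₁)))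
    filter_upwards [h] with X hX
    rw [id, Real.norm_of_nonneg (by positivity : (0 : ℝ) ≤ X)] at hX
    exact (le_abs_self _).trans hX
  have e3 : ∀ᶠ X : ℕ in atTop,
      Real.log X ≤ η * Real.exp (-ε) / (2 * c₁) * (X : ℝ) ^ (1 - θ) := by
    have h := tendsto_natCast_atTop_atTop.eventually
      ((isLittleO_log_rpow_atTop (sub_pos.2 hθ1)).def
        (by positivity : 0 < η * Real.exp (-ε) / (2 * c₁)))
    filter_upwards [h] with X hX
    rw [Real.norm_of_nonneg (by positivity : (0 : ℝ) ≤ (X : ℝ) ^ (1 - θ))] at hX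
    exact (le_abs_self _).trans hX
  have h1 := (tendsto_repMean hs).eventually_lt_const hl1
  rw [eventually_atTop] at h1
  obtain ⟨N, hN⟩ := h1
  filter_upwards [eventually_measureReal_missEvent hs hA (2 * c₁) ε hε0, e1, e2, e3,
    eventually_ge_atTop N, eventually_ge_atTop 2] with X hX h1 h2 h3 hXN hX2
  have hX0 : (0 : ℝ) < X := by exact_mod_cast (by omega : 0 < X)
  have hlog : 0 < Real.log X := Real.log_pos (by exact_mod_cast hX2)
  set L := ⌈c * Real.log (2 * X)⌉₊ with hL
  have hlog2 : 0 < Real.log (2 * X) := Real.log_pos (by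
    have : (2 : ℝ) ≤ X := by exact_mod_cast hX2
    linarith)
  have hL0 : 0 < L := Nat.ceil_pos.2 (by positivity)
  have hLR : (0 : ℝ) < L := by exact_mod_cast hL0
  have hLle : (L : ℝ) ≤ c₁ * Real.log X := by
    have h4 : (L : ℝ) < c * Real.log (2 * X) + 1 := Nat.ceil_lt_add_one (by positivity)
    rw [Real.log_mul (by norm_num) hX0.ne'] at h4
    rw [div_le_iff₀ (by linarith)] at h1
    linarith
  set M := X / L with hM
  set T : ℕ → Finset ℕ := fun i => Finset.Ico (X + i * L) (X + i * L + L) with hT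
  have hTX : ∀ i, ∀ m ∈ T i, X ≤ m := fun i m hm =>
    (Nat.le_add_right _ _).trans (Finset.mem_Ico.1 hm).1
  have hTcard : ∀ i, (T i).card = L := fun i => by simp [hT]
  have hTdisj : ∀ i j, i ≠ j → Disjoint (T i) (T j) := by
    intro i j hij
    rw [Finset.disjoint_left]
    intro m hm hm'
    rw [hT, Finset.mem_Ico] at hm hm'
    rcases lt_or_gt_of_ne hij with h | h
    · have := Nat.mul_le_mul_right L (Nat.succ_le_of_lt h)
      rw [Nat.succ_mul] at this
      omega
    · have := Nat.mul_le_mul_right L (Nat.succ_le_of_lt h)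
      rw [Nat.succ_mul] at this
      omega
  set E : ℕ → Set U := fun i => missEvent s A (T i) with hE
  set μ : ℕ → ℝ := fun i => ∑ m ∈ T i, repMean s s m with hμ
  have hlow : ∀ i, Real.exp (-μ i - ε) ≤ P.real (E i) := fun i =>
    (hX (T i) (hTX i) (by rw [hTcard]; linarith)).1
  have hpair : ∀ i ∈ Finset.range M, ∀ j ∈ Finset.range M, i ≠ j →
      P.real (E i ∩ E j) ≤ (1 + η) * (P.real (E i) * P.real (E j)) := by
    intro i _ j _ hij
    have h4 := (hX (T i ∪ T j) (fun m hm => (Finset.mem_union.1 hm).elim (hTX i m) (hTX j m))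
      (by rw [Finset.card_union_of_disjoint (hTdisj i j hij), hTcard, hTcard]; push_cast
          linarith)).2
    rw [missEvent_union, Finset.sum_union (hTdisj i j hij)] at h4
    calc P.real (E i ∩ E j) ≤ Real.exp (-(μ i + μ j) + ε) := h4
      _ = (1 + η) * (Real.exp (-μ i - ε) * Real.exp (-μ j - ε)) := by
          rw [← hexp, ← Real.exp_add, ← Real.exp_add]
          congr 1
          ring
      _ ≤ _ := mul_le_mul_of_nonneg_left
          (mul_le_mul (hlow i) (hlow j) (Real.exp_pos _).le measureReal_nonneg) (by linarith)
  -- The expected number of empty windows is at least a constant times `X ^ (1 - θ) / log X`.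
  have hSlow : 1 / η ≤ ∑ i ∈ Finset.range M, P.real (E i) := by
    have hterm : ∀ i ∈ Finset.range M, Real.exp (-ε) * (X : ℝ) ^ (-θ) ≤ P.real (E i) := by
      intro i _
      refine le_trans ?_ (hlow i)
      rw [Real.rpow_def_of_pos hX0, ← Real.exp_add]
      refine Real.exp_le_exp.2 ?_
      have h5 : μ i ≤ l * (c₁ * Real.log X) := by
        calc μ i ≤ ∑ m ∈ T i, l := Finset.sum_le_sum fun m hm =>
              (hN m (hXN.trans (hTX i m hm))).le
          _ = l * L := by rw [Finset.sum_const, hTcard, nsmul_eq_mul, mul_comm]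
          _ ≤ _ := mul_le_mul_of_nonneg_left hLle hl0.le
      rw [hθ]
      linarith
    have hMlow : (X : ℝ) / (2 * (c₁ * Real.log X)) ≤ M := by
      have h6 : X < L * (M + 1) := Nat.lt_mul_div_succ X hL0
      have h7 : (X : ℝ) < L * (M + 1) := by exact_mod_cast h6
      have h8 : 2 * (c₁ * Real.log X) ≤ X := by
        calc 2 * (c₁ * Real.log X) ≤ 2 * (c₁ * (1 / (2 * c₁) * X)) := by gcongr
          _ = X := by field_simp
      have h9 : (1 : ℝ) ≤ M := by
        have : 1 ≤ M := (Nat.one_le_div_iff hL0).2 (by exact_mod_cast (by linarith : (L : ℝ) ≤ X))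
        exact_mod_cast this
      rw [div_le_iff₀ (by positivity)]
      nlinarith
    calc 1 / η ≤ (X : ℝ) / (2 * (c₁ * Real.log X)) * (Real.exp (-ε) * (X : ℝ) ^ (-θ)) := by
          rw [sub_eq_add_neg, Real.rpow_add hX0, Real.rpow_one] at h3
          rw [div_mul_eq_mul_div, div_le_div_iff₀ hη (by positivity), one_mul]
          calc 2 * (c₁ * Real.log X) ≤ 2 * (c₁ * (η * Real.exp (-ε) / (2 * c₁) *
                ((X : ℝ) * (X : ℝ) ^ (-θ)))) := by gcongr
            _ = _ := by field_simp
      _ ≤ M * (Real.exp (-ε) * (X : ℝ) ^ (-θ)) :=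
          mul_le_mul_of_nonneg_right hMlow (by positivity)
      _ = ∑ i ∈ Finset.range M, Real.exp (-ε) * (X : ℝ) ^ (-θ) := by
          rw [Finset.sum_const, Finset.card_range, nsmul_eq_mul]
      _ ≤ _ := Finset.sum_le_sum hterm
  have hSpos : 0 < ∑ i ∈ Finset.range M, P.real (E i) := (one_div_pos.2 hη).trans_le hSlow
  have hfin := measureReal_iInter_compl_le (Finset.range M)
    (fun i => measurableSet_missEvent hA (T i)) hη.le hSpos hpair
  have hinv : 1 / ∑ i ∈ Finset.range M, P.real (E i) ≤ η := (one_div_le hη hSpos).1 hSlow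
  refine (measureReal_mono ?_ (measure_ne_top _ _)).trans (hfin.trans (by linarith))
  intro u hu
  refine Set.mem_iInter₂.2 fun i hi hui => hu ?_
  refine ⟨X + i * L, L, Nat.le_add_right _ _, ?_, Nat.le_ceil _, fun m hm1 hm2 =>
    hui m (Finset.mem_Ico.2 ⟨hm1, hm2⟩)⟩
  have h10 := Nat.mul_le_mul_right L (Nat.succ_le_of_lt (Finset.mem_range.1 hi))
  rw [Nat.succ_mul] at h10
  have h11 : M * L ≤ X := Nat.div_mul_le_self X L
  omega

lemma ae_frequently_longGapEvent [IsProbabilityMeasure P] (hs : 2 ≤ s)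
    (hA : IsPseudoPowerSequence P s A) {c : ℝ} (hc0 : 0 < c) (hc : c < 1 / poissonParam s) :
    ∀ᵐ u ∂P, ∃ᶠ X : ℕ in atTop, u ∈ longGapEvent s A c X := by
  have hnull : ∀ n : ℕ, P {u | ∀ X, n ≤ X → u ∉ longGapEvent s A c X} = 0 := by
    intro n
    rw [← measureReal_eq_zero_iff]
    refine le_antisymm (le_of_forall_pos_le_add fun η hη => ?_) measureReal_nonneg
    obtain ⟨X, hX, hnX⟩ := ((eventually_measureReal_longGapEvent hs hA hc0 hc (half_pos hη)).and
      (eventually_ge_atTop n)).exists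
    have hsub : {u | ∀ X, n ≤ X → u ∉ longGapEvent s A c X} ⊆ (longGapEvent s A c X)ᶜ :=
      fun u hu => hu X hnX
    have := measureReal_mono (μ := P) hsub (measure_ne_top _ _)
    linarith
  have hall : ∀ᵐ u ∂P, ∀ n : ℕ, ¬ ∀ X, n ≤ X → u ∉ longGapEvent s A c X := by
    rw [ae_all_iff]
    intro n
    rw [ae_iff]
    simpa only [not_not] using hnull n
  filter_upwards [hall] with u hu
  rw [frequently_atTop]
  intro n
  have := hu n
  push Not at this
  exact this

end LongGaps

/-! ### Gaps between consecutive elements of a set -/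

section Enumeration

variable {B : Set ℕ}

lemma increasingEnum_strictMono (hB : B.Infinite) : StrictMono (increasingEnum B) :=
  Nat.nth_strictMono hB

lemma tendsto_increasingEnum (hB : B.Infinite) : Tendsto (increasingEnum B) atTop atTop :=
  (increasingEnum_strictMono hB).tendsto_atTop

lemma increasingEnum_succ_le (hB : B.Infinite) {n m : ℕ} (hm : m ∈ B)
    (h : increasingEnum B n < m) : increasingEnum B (n + 1) ≤ m := by
  classical
  have hm' : increasingEnum B (Nat.count (· ∈ B) m) = m := Nat.nth_count hm
  rw [← hm'] at h ⊢
  exact (increasingEnum_strictMono hB).monotone ((increasingEnum_strictMono hB).lt_iff_lt.1 h)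

/-- A gap `[y, y + L)` of `B` beyond `increasingEnum B N` lies between two consecutive elements of
`B` of index at least `N`. -/
lemma exists_increasingEnum_gap (hB : B.Infinite) {N y L : ℕ} (hy : increasingEnum B N < y)
    (hgap : ∀ m, y ≤ m → m < y + L → m ∉ B) :
    ∃ n, N ≤ n ∧ increasingEnum B n < y ∧ y + L ≤ increasingEnum B (n + 1) := by
  classical
  have hcount : N < Nat.count (· ∈ B) y := by
    by_contra! h
    exact absurd ((Nat.le_nth_count (p := (· ∈ B)) hB y).trans
      ((increasingEnum_strictMono hB).monotone h))
      (not_le.2 hy)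
  refine ⟨Nat.count (· ∈ B) y - 1, by omega, Nat.nth_lt_of_lt_count (by omega), ?_⟩
  rw [Nat.sub_add_cancel (by omega)]
  by_contra! h
  exact hgap _ (Nat.le_nth_count (p := (· ∈ B)) hB y) h (Nat.nth_mem_of_infinite hB _)

lemma infinite_of_eventually_exists_mem {Q : ℕ → ℕ → Prop}
    (h : ∀ᶠ x : ℕ in atTop, ∃ m ∈ B, x < m ∧ Q x m) : B.Infinite := by
  rw [Set.infinite_iff_exists_gt]
  intro a
  obtain ⟨x, ⟨m, hm, hxm, -⟩, hax⟩ := (h.and (eventually_ge_atTop a)).exists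
  exact ⟨m, hm, hax.trans_lt hxm⟩

lemma eventually_gap_ratio_le (hB : B.Infinite) {c : ℝ}
    (h : ∀ᶠ x : ℕ in atTop, ∃ m ∈ B, x < m ∧ (m : ℝ) - x ≤ c * Real.log x) :
    ∀ᶠ n : ℕ in atTop, ((increasingEnum B (n + 1) : ℝ) - (increasingEnum B n : ℝ))
      / Real.log (increasingEnum B n : ℝ) ≤ c := by
  have ht := tendsto_increasingEnum hB
  filter_upwards [ht.eventually h, ht.eventually (eventually_ge_atTop 2)] with n hn h2
  obtain ⟨m, hm, hlt, hle⟩ := hn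
  have hlog : 0 < Real.log (increasingEnum B n : ℝ) := Real.log_pos (by exact_mod_cast h2)
  rw [div_le_iff₀ hlog]
  have : (increasingEnum B (n + 1) : ℝ) ≤ m := by exact_mod_cast increasingEnum_succ_le hB hm hlt
  linarith

lemma frequently_le_gap_ratio (hB : B.Infinite) {c : ℝ} (hc : 0 < c)
    (h : ∃ᶠ X : ℕ in atTop, ∃ y L : ℕ, X ≤ y ∧ y + L ≤ 2 * X ∧ c * Real.log (2 * X) ≤ L ∧
      ∀ m, y ≤ m → m < y + L → m ∉ B) :
    ∃ᶠ n : ℕ in atTop, c ≤ ((increasingEnum B (n + 1) : ℝ) - (increasingEnum B n : ℝ))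
      / Real.log (increasingEnum B n : ℝ) := by
  rw [frequently_atTop] at h ⊢
  intro N
  obtain ⟨X, hX, y, L, hXy, hyL, hL, hgap⟩ := h (increasingEnum B (max N 2) + 1)
  obtain ⟨n, hn, hny, hnL⟩ := exists_increasingEnum_gap hB (N := max N 2) (y := y) (by omega) hgap
  refine ⟨n, (le_max_left _ _).trans hn, ?_⟩
  have h2 : 2 ≤ increasingEnum B n :=
    ((le_max_right _ _).trans hn).trans ((increasingEnum_strictMono hB).le_apply)
  have hlog : 0 < Real.log (increasingEnum B n : ℝ) := Real.log_pos (by exact_mod_cast h2)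
  rw [le_div_iff₀ hlog]
  have h3 : Real.log (increasingEnum B n : ℝ) ≤ Real.log (2 * X) :=
    Real.log_le_log (by exact_mod_cast (by omega : 0 < increasingEnum B n))
      (by exact_mod_cast (by omega : increasingEnum B n ≤ 2 * X))
  have h4 : (increasingEnum B n : ℝ) + L ≤ increasingEnum B (n + 1) := by
    exact_mod_cast (by omega : increasingEnum B n + L ≤ increasingEnum B (n + 1))
  have h5 := mul_le_mul_of_nonneg_left h3 hc.le
  linarith

lemma limsup_eq_of_approx {r : ℕ → ℝ} {Λ : ℝ} {a b : ℕ → ℝ}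
    (ha : Tendsto a atTop (nhds Λ)) (hb : Tendsto b atTop (nhds Λ))
    (hupper : ∀ k, ∀ᶠ n in atTop, r n ≤ b k) (hlower : ∀ k, ∃ᶠ n in atTop, a k ≤ r n) :
    limsup (fun n => (r n : EReal)) atTop = (Λ : EReal) := by
  refine le_antisymm ?_ ?_
  · refine ge_of_tendsto' ((continuous_coe_real_ereal.tendsto _).comp hb) fun k => ?_
    refine limsup_le_of_le (by isBoundedDefault) ?_
    filter_upwards [hupper k] with n hn
    exact EReal.coe_le_coe_iff.2 hn
  · refine le_of_tendsto' ((continuous_coe_real_ereal.tendsto _).comp ha) fun k => ?_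
    refine le_limsup_of_frequently_le ?_ (by isBoundedDefault)
    exact (hlower k).mono fun n hn => EReal.coe_le_coe_iff.2 hn

end Enumeration

end PseudoPower

/-- The upper limit is taken in the extended reals, so that it is a genuine one. -/
theorem theorem1 {U : Type*} [MeasurableSpace U] (P : Measure U) [IsProbabilityMeasure P]
    (s : ℕ) (hs : 2 ≤ s) (A : U → Set ℕ) (hA : IsPseudoPowerSequence P s A) :
    (∀ᵐ u ∂P, (foldSumset s (A u)).Infinite ∧
      limsup (fun n : ℕ =>
          ((((increasingEnum (foldSumset s (A u)) (n + 1) : ℝ)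
              - (increasingEnum (foldSumset s (A u)) n : ℝ))
            / Real.log (increasingEnum (foldSumset s (A u)) n : ℝ) : ℝ) : EReal)) atTop
        = (((s : ℝ) ^ s * (Nat.factorial s : ℝ) / Real.Gamma (1 / (s : ℝ)) ^ s : ℝ) : EReal)) ∧
    (s : ℝ) ^ s * (Nat.factorial s : ℝ) / Real.Gamma (1 / (s : ℝ)) ^ s = 1 / poissonParam s := by
  have heq : (s : ℝ) ^ s * (Nat.factorial s : ℝ) / Real.Gamma (1 / (s : ℝ)) ^ s =
      1 / poissonParam s := by
    rw [poissonParam, one_div_div]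
  refine ⟨?_, heq⟩
  rw [heq]
  set Λ := 1 / poissonParam s with hΛ
  have hΛ0 : 0 < Λ := one_div_pos.2 (PseudoPower.poissonParam_pos hs)
  have hz : Tendsto (fun k : ℕ => Λ / ((k : ℝ) + 2)) atTop (nhds 0) :=
    tendsto_const_nhds.div_atTop
      (tendsto_atTop_add_const_right _ _ tendsto_natCast_atTop_atTop)
  have ha : Tendsto (fun k : ℕ => Λ - Λ / ((k : ℝ) + 2)) atTop (nhds Λ) := by
    simpa using hz.const_sub Λ
  have hb : Tendsto (fun k : ℕ => Λ + Λ / ((k : ℝ) + 2)) atTop (nhds Λ) := by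
    simpa using hz.const_add Λ
  have hpos : ∀ k : ℕ, 0 < Λ / ((k : ℝ) + 2) := fun k => by positivity
  have hlt : ∀ k : ℕ, 0 < Λ - Λ / ((k : ℝ) + 2) := fun k =>
    sub_pos.2 (div_lt_self hΛ0 (lt_add_of_nonneg_of_lt k.cast_nonneg one_lt_two))
  have hU := ae_all_iff.2 fun k : ℕ => PseudoPower.ae_eventually_exists_mem hs hA
    (c := Λ + Λ / ((k : ℝ) + 2)) (by linarith [hpos k])
  have hL := ae_all_iff.2 fun k : ℕ => PseudoPower.ae_frequently_longGapEvent hs hA (hlt k)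
    (by linarith [hpos k])
  filter_upwards [hU, hL] with u hu hl
  have hinf : (foldSumset s (A u)).Infinite :=
    PseudoPower.infinite_of_eventually_exists_mem (hu 0)
  exact ⟨hinf, PseudoPower.limsup_eq_of_approx ha hb
    (fun k => PseudoPower.eventually_gap_ratio_le hinf (hu k))
    fun k => PseudoPower.frequently_le_gap_ratio hinf (hlt k) (hl k)⟩
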